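/- **Setting.** Let $K$ be a field, $P=K[x_1,\dots,x_n]$, let $W\in\mathrm{Mat}_{m,n}(\mathbb Z)$ have rank $m\ge 1$, and let $\overline P=K[y_1,\dots,y_m,x_1,\dots,x_n]$ be $\mathbb Z^m$-graded by $\overline W=(I_m\mid W)$. Let $r\ge 1$, $F=P^r$ with canonical basis $e_1,\dots,e_r$, let $\delta_1,\dots,\delta_r\in\mathbb Z^m$, and let $\overline F=\bigoplus_{i}\overline P(-\delta_i)$, so that $\deg(te_i)=\deg_{\overline W}(t)+\delta_i$; likewise $\deg_W(te_i)=\deg_W(t)+\delta_i$ for terms of $F$. A *module ordering* is a total ordering of the terms $te_i$ that is compatible with multiplication by power products and with some monoid ordering on the power products; it is a *module term ordering* if moreover $t'\cdot te_i\ge te_i$ always. Let $\sigma$ be a module ordering on the terms of $F$. Its extension $\overline\sigma$ compares two terms of $\overline F$ first by their degrees (lexicographically in $\mathbb Z^m$) and then, if these are equal, by $\sigma$ applied to the terms obtained by setting all $y_k=1$. For $v=\sum_j c_jt_je_{i_j}\in F\setminus\{0\}$ (distinct terms, $c_j\neq0$), put $\tau_j=\deg_W(t_je_{i_j})$ and let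 $\mu$ be the componentwise maximum of the $\tau_j$; then $v^{\rm hom}=\sum_j c_j\,y^{\mu-\tau_j}t_je_{i_j}$, and $0^{\rm hom}=0$. For $V\in\overline F$, $V^{\rm deh}\in F$ is obtained by setting all $y_k=1$. For homogeneous $V$, $V^{\rm sat}=(V^{\rm deh})^{\rm hom}$. A set $G$ is a *$\sigma$-Gröbner basis* of a submodule $M\subseteq F$ if $0\notin G$, $G$ generates $M$, and the leading term of each non-zero element of $M$ is divisible by the leading term of an element of $G$. **Weak Self-Saturating Buchberger's Algorithm** (WeakSelfSatBA), on input homogeneous vectors $U_1,\dots,U_s\in\overline F$, with all leading terms taken with respect to $\overline\sigma$. Start with $\mathrm{Gens}=(U_1,\dots,U_s)$, $\mathrm{Pairs}=\emptyset$, $\mathcal G=\emptyset$. While $\mathrm{Gens}\neq\emptyset$ or $\mathrm{Pairs}\ne\emptyset$: * choose and remove an element $R$ of $\mathrm{Gens}$, or choose and remove a pair $(U,V)$ of $\mathrm{Pairs}$ and let $R$ be the S-vector of $U,V$; * compute a weak saturating remainder of $R$ by $\mathcal G$: finitely many times, replace $R$ by any homogeneous $R'$ with $(R')^{\rm sat}=R^{\rm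 sat}$ (possibly $R'=R$) and then perform a division step, i.e. replace $R'$ by $R'-c\,t\,U$ with $U\in\mathcal G$, where $t\,\mathrm{LT}(U)$ occurs in $R'$ and $c\in K$ is chosen to cancel it; finally replace $R$ by a homogeneous $V$ with $V^{\rm sat}=R^{\rm sat}$ such that $V=0$ or $\mathrm{LT}(V)$ is not divisible by $\mathrm{LT}(U)$ for any $U\in\mathcal G$; * if $V\neq0$, add to $\mathrm{Pairs}$ the pairs $(V,U)$ for all $U\in\mathcal G$ whose leading term lies in the same component as that of $V$, and add $V$ to $\mathcal G$. Return $\mathcal G$. All choices are arbitrary. **Theorem.** Let $v_1,\dots,v_s$ be non-zero vectors in $F$ and let $M\subseteq F$ be the submodule they generate. If $\{V_1,\dots,V_t\}$ is the output of any run of any WeakSelfSatBA applied to $v_1^{\rm hom},\dots,v_s^{\rm hom}$, then $\{V_1^{\rm deh},\dots,V_t^{\rm deh}\}$ is a $\sigma$-Gröbner basis of $M$. Moreover, if $\sigma$ is a module term ordering, then the procedure is indeed an algorithm: no run on this input is infinite, and every run can be continued until it stops with an output. -/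

import Mathlib

namespace SelfSat

/-! ## Terms, supports, orderings

`ModTerm ι r` is the set of terms `t e_i` of the free module of rank `r` over the polynomial ring
with indeterminates indexed by `ι`; the pair `(i, a)` stands for `x ^ a • e_i`. -/

abbrev ModTerm (ι : Type) (r : ℕ) : Type := Fin r × (ι →₀ ℕ)

/-- The free module of rank `r` over the polynomial ring `K[x_j | j ∈ ι]`. -/
abbrev FreeVec (K : Type*) [Field K] (ι : Type) (r : ℕ) := Fin r → MvPolynomial ι K

/-- Multiplication of a module term by a power product. -/
noncomputable def ModTerm.shift {ι : Type} {r : ℕ} (c : ι →₀ ℕ) (T : ModTerm ι r) : ModTerm ι r :=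
  (T.1, c + T.2)

/-- The term `S` divides the term `T`, that is, `T = x ^ c • S` for some `c`. -/
def ModTerm.Dvd {ι : Type} {r : ℕ} (S T : ModTerm ι r) : Prop :=
  ∃ c : ι →₀ ℕ, T = ModTerm.shift c S

/-- Monoid orderings: total orderings on the power products, compatible with multiplication
(not necessarily term orderings). -/
structure MonoidOrdering (ι : Type) where
  le : (ι →₀ ℕ) → (ι →₀ ℕ) → Prop
  trans : ∀ a b c, le a b → le b c → le a c
  antisymm : ∀ a b, le a b → le b a → a = b
  total : ∀ a b, le a b ∨ le b a
  mul_le : ∀ c a b, le a b → le (c + a) (c + b)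

/-- Module orderings: total orderings on the terms of the free module, compatible with
multiplication by power products, and compatible with some monoid ordering. -/
structure ModuleOrdering (ι : Type) (r : ℕ) where
  le : ModTerm ι r → ModTerm ι r → Prop
  trans : ∀ S T U, le S T → le T U → le S U
  antisymm : ∀ S T, le S T → le T S → S = T
  total : ∀ S T, le S T ∨ le T S
  mul_le : ∀ c S T, le S T → le (S.shift c) (T.shift c)
  compat : ∃ τ : MonoidOrdering ι, ∀ a b, τ.le a b → ∀ T : ModTerm ι r,
    le (T.shift a) (T.shift b)

/-- Module term orderings: multiplying by a power product never makes a term smaller. -/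
def ModuleOrdering.IsTermOrdering {ι : Type} {r : ℕ} (σ : ModuleOrdering ι r) : Prop :=
  ∀ (c : ι →₀ ℕ) (T : ModTerm ι r), σ.le T (T.shift c)

section Vectors

variable {K : Type*} [Field K] {ι : Type} {r : ℕ}

open Classical in
/-- The finite set of terms that occur in `v` with a non-zero coefficient. -/
noncomputable def supp (v : FreeVec K ι r) : Finset (ModTerm ι r) :=
  Finset.univ.biUnion fun i => (v i).support.image (Prod.mk i)

theorem mem_supp (v : FreeVec K ι r) (T : ModTerm ι r) :
    T ∈ supp v ↔ MvPolynomial.coeff T.2 (v T.1) ≠ 0 := by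
  obtain ⟨i, t⟩ := T
  simp [supp]

theorem supp_nonempty {v : FreeVec K ι r} (hv : v ≠ 0) : (supp v).Nonempty := by
  obtain ⟨i, hi⟩ := Function.ne_iff.1 hv
  obtain ⟨t, ht⟩ := MvPolynomial.ne_zero_iff.1 hi
  exact ⟨(i, t), (mem_supp v (i, t)).2 ht⟩

/-- `T` is the `σ`-largest term in the support of `v`. -/
def IsLeadTerm (σ : ModuleOrdering ι r) (v : FreeVec K ι r) (T : ModTerm ι r) : Prop :=
  T ∈ supp v ∧ ∀ S ∈ supp v, σ.le S T

theorem exists_isLeadTerm (σ : ModuleOrdering ι r) {v : FreeVec K ι r} (hv : v ≠ 0) :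
    ∃ T, IsLeadTerm σ v T := by
  have key : ∀ s : Finset (ModTerm ι r), s.Nonempty → ∃ T ∈ s, ∀ S ∈ s, σ.le S T := by
    intro s hs
    induction hs using Finset.Nonempty.cons_induction with
    | singleton a =>
      refine ⟨a, by simp, fun S hS => ?_⟩
      rw [Finset.mem_singleton.1 hS]
      exact (σ.total a a).elim id id
    | cons a s ha hs ih =>
      obtain ⟨T, hT, hmax⟩ := ih
      rcases σ.total a T with h | h
      · refine ⟨T, Finset.mem_cons_of_mem hT, fun S hS => ?_⟩
        rcases Finset.mem_cons.1 hS with rfl | hS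
        · exact h
        · exact hmax S hS
      · refine ⟨a, Finset.mem_cons_self a s, fun S hS => ?_⟩
        rcases Finset.mem_cons.1 hS with rfl | hS
        · exact (σ.total S S).elim id id
        · exact σ.trans _ _ _ (hmax S hS) h
  exact key _ (supp_nonempty hv)

/-- The leading term of a vector (an arbitrary value if the vector is zero). -/
noncomputable def leadTerm [NeZero r] (σ : ModuleOrdering ι r) (v : FreeVec K ι r) :
    ModTerm ι r :=
  Classical.epsilon (IsLeadTerm σ v)

theorem leadTerm_spec [NeZero r] (σ : ModuleOrdering ι r) {v : FreeVec K ι r} (hv : v ≠ 0) :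
    IsLeadTerm σ v (leadTerm σ v) :=
  Classical.epsilon_spec (exists_isLeadTerm σ hv)

/-- The leading coefficient of a vector. -/
noncomputable def leadCoeff [NeZero r] (σ : ModuleOrdering ι r) (v : FreeVec K ι r) : K :=
  MvPolynomial.coeff (leadTerm σ v).2 (v (leadTerm σ v).1)

/-- The S-vector of two non-zero vectors whose leading terms lie in the same component:
`lcm (t_u, t_v) / (c_u t_u) • u - lcm (t_u, t_v) / (c_v t_v) • v`. -/
noncomputable def sVector [NeZero r] (σ : ModuleOrdering ι r) (u v : FreeVec K ι r) :
    FreeVec K ι r :=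
  MvPolynomial.monomial (((leadTerm σ u).2 ⊔ (leadTerm σ v).2) - (leadTerm σ u).2)
      (leadCoeff σ u)⁻¹ • u -
    MvPolynomial.monomial (((leadTerm σ u).2 ⊔ (leadTerm σ v).2) - (leadTerm σ v).2)
      (leadCoeff σ v)⁻¹ • v

/-- `G` is a `σ`-Gröbner basis of `M`: it consists of non-zero elements, it generates `M`, and the
leading terms of its elements generate the monomodule of the leading terms of `M`. -/
def IsGroebnerBasis [NeZero r] (σ : ModuleOrdering ι r)
    (M : Submodule (MvPolynomial ι K) (FreeVec K ι r)) (G : Set (FreeVec K ι r)) : Prop :=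
  (∀ g ∈ G, g ≠ 0) ∧ Submodule.span (MvPolynomial ι K) G = M ∧
    ∀ u ∈ M, u ≠ 0 → ∃ g ∈ G, (leadTerm σ g).Dvd (leadTerm σ u)

/-- One step of division by the elements of `G`: for some `g ∈ G` and some power product `x ^ a`
such that `x ^ a • LT(g)` occurs in `R`, the vector `R` is replaced by `R - c x ^ a • g`, where `c`
is chosen such that the term `x ^ a • LT(g)` cancels. -/
def DivisionStep [NeZero r] (σ : ModuleOrdering ι r) (G : Multiset (FreeVec K ι r))
    (R R' : FreeVec K ι r) : Prop :=
  ∃ g ∈ G, ∃ a : ι →₀ ℕ, (leadTerm σ g).shift a ∈ supp R ∧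
    R' = R - MvPolynomial.monomial a
      (MvPolynomial.coeff (a + (leadTerm σ g).2) (R (leadTerm σ g).1) / leadCoeff σ g) • g

end Vectors

/-! ## Degrees, homogenization, dehomogenization -/

section Homogenization

variable {K : Type*} [Field K] {m n r : ℕ}

/-- The degree in `ℤ ^ m` of a term `t e_i`, for the grading given by the matrix `A` and the degrees
`δ i` of the basis vectors `e_i`. -/
def deg {ι : Type} [Fintype ι] (A : Matrix (Fin m) ι ℤ) (δ : Fin r → Fin m → ℤ)
    (T : ModTerm ι r) : Fin m → ℤ :=
  A.mulVec (fun j => (T.2 j : ℤ)) + δ T.1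

/-- The matrix `(I_m | W)`; the index `Sum.inl k` belongs to the homogenizing indeterminate `y_k`
and the index `Sum.inr j` to `x_j`. -/
def extMatrix (W : Matrix (Fin m) (Fin n) ℤ) : Matrix (Fin m) (Fin m ⊕ Fin n) ℤ :=
  Matrix.fromCols 1 W

/-- Dehomogenization of power products: forget the exponents of the `y_k`. -/
noncomputable def dehExp (a : Fin m ⊕ Fin n →₀ ℕ) : Fin n →₀ ℕ :=
  a.comapDomain Sum.inr Sum.inr_injective.injOn

/-- Dehomogenization of module terms. -/
noncomputable def dehTerm (T : ModTerm (Fin m ⊕ Fin n) r) : ModTerm (Fin n) r :=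
  (T.1, dehExp T.2)

theorem dehExp_add (a b : Fin m ⊕ Fin n →₀ ℕ) : dehExp (a + b) = dehExp a + dehExp b := by
  ext j; simp [dehExp]

theorem deg_extMatrix (W : Matrix (Fin m) (Fin n) ℤ) (δ : Fin r → Fin m → ℤ)
    (T : ModTerm (Fin m ⊕ Fin n) r) (k : Fin m) :
    deg (extMatrix W) δ T k = (T.2 (Sum.inl k) : ℤ) + deg W δ (dehTerm T) k := by
  simp [deg, extMatrix, dehTerm, dehExp, Matrix.mulVec, dotProduct, add_assoc]

theorem deg_shift {ι : Type} [Fintype ι] (A : Matrix (Fin m) ι ℤ) (δ : Fin r → Fin m → ℤ)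
    (c : ι →₀ ℕ) (T : ModTerm ι r) :
    deg A δ (T.shift c) = A.mulVec (fun j => (c j : ℤ)) + deg A δ T := by
  have h : (fun j => ((c + T.2) j : ℤ)) = (fun j => (c j : ℤ)) + fun j => (T.2 j : ℤ) := by
    ext j; simp
  simp only [deg, ModTerm.shift, h, Matrix.mulVec_add, add_assoc]

theorem eq_of_deg_eq (W : Matrix (Fin m) (Fin n) ℤ) (δ : Fin r → Fin m → ℤ)
    {S T : ModTerm (Fin m ⊕ Fin n) r} (hd : deg (extMatrix W) δ S = deg (extMatrix W) δ T)
    (h : dehTerm S = dehTerm T) : S = T := by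
  have h1 : S.1 = T.1 := congrArg (fun U : ModTerm (Fin n) r => U.1) h
  refine Prod.ext h1 (Finsupp.ext ?_)
  rintro (k | j)
  · have := congrFun hd k
    rw [deg_extMatrix, deg_extMatrix, h] at this
    exact_mod_cast add_right_cancel this
  · have := DFunLike.congr_fun (congrArg (fun U : ModTerm (Fin n) r => U.2) h) j
    simpa [dehTerm, dehExp] using this

/-- The relation defining the extension of an ordering by `W`, on the terms of the module: first
compare the degrees lexicographically in `ℤ ^ m`, then the dehomogenized terms. -/
def ExtLE (W : Matrix (Fin m) (Fin n) ℤ) (δ : Fin r → Fin m → ℤ)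
    (le : ModTerm (Fin n) r → ModTerm (Fin n) r → Prop)
    (S T : ModTerm (Fin m ⊕ Fin n) r) : Prop :=
  toLex (deg (extMatrix W) δ S) < toLex (deg (extMatrix W) δ T) ∨
    deg (extMatrix W) δ S = deg (extMatrix W) δ T ∧ le (dehTerm S) (dehTerm T)

theorem ExtLE.trans {W : Matrix (Fin m) (Fin n) ℤ} {δ : Fin r → Fin m → ℤ}
    {le : ModTerm (Fin n) r → ModTerm (Fin n) r → Prop}
    (hle : ∀ S T U, le S T → le T U → le S U) {S T U : ModTerm (Fin m ⊕ Fin n) r}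
    (h₁ : ExtLE W δ le S T) (h₂ : ExtLE W δ le T U) : ExtLE W δ le S U := by
  rcases h₁ with h₁ | ⟨h₁, h₁'⟩ <;> rcases h₂ with h₂ | ⟨h₂, h₂'⟩
  · exact Or.inl (h₁.trans h₂)
  · exact Or.inl (h₂ ▸ h₁)
  · exact Or.inl (h₁ ▸ h₂)
  · exact Or.inr ⟨h₁.trans h₂, hle _ _ _ h₁' h₂'⟩

theorem ExtLE.antisymm {W : Matrix (Fin m) (Fin n) ℤ} {δ : Fin r → Fin m → ℤ}
    {le : ModTerm (Fin n) r → ModTerm (Fin n) r → Prop}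
    (hle : ∀ S T, le S T → le T S → S = T) {S T : ModTerm (Fin m ⊕ Fin n) r}
    (h₁ : ExtLE W δ le S T) (h₂ : ExtLE W δ le T S) : S = T := by
  rcases h₁ with h₁ | ⟨h₁, h₁'⟩ <;> rcases h₂ with h₂ | ⟨h₂, h₂'⟩
  · exact absurd h₂ h₁.asymm
  · rw [h₂] at h₁; exact absurd h₁ (lt_irrefl _)
  · rw [h₁] at h₂; exact absurd h₂ (lt_irrefl _)
  · exact eq_of_deg_eq W δ h₁ (hle _ _ h₁' h₂')

theorem ExtLE.total {W : Matrix (Fin m) (Fin n) ℤ} {δ : Fin r → Fin m → ℤ}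
    {le : ModTerm (Fin n) r → ModTerm (Fin n) r → Prop}
    (hle : ∀ S T, le S T ∨ le T S) (S T : ModTerm (Fin m ⊕ Fin n) r) :
    ExtLE W δ le S T ∨ ExtLE W δ le T S := by
  rcases lt_trichotomy (toLex (deg (extMatrix W) δ S)) (toLex (deg (extMatrix W) δ T)) with
    h | h | h
  · exact Or.inl (Or.inl h)
  · have h := toLex.injective h
    rcases hle (dehTerm S) (dehTerm T) with h' | h'
    · exact Or.inl (Or.inr ⟨h, h'⟩)
    · exact Or.inr (Or.inr ⟨h.symm, h'⟩)
  · exact Or.inr (Or.inl h)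

theorem dehTerm_shift (c : Fin m ⊕ Fin n →₀ ℕ) (T : ModTerm (Fin m ⊕ Fin n) r) :
    dehTerm (T.shift c) = (dehTerm T).shift (dehExp c) := by
  simp [dehTerm, ModTerm.shift, dehExp_add]

theorem ExtLE.shift {W : Matrix (Fin m) (Fin n) ℤ} {δ : Fin r → Fin m → ℤ}
    {le : ModTerm (Fin n) r → ModTerm (Fin n) r → Prop}
    (hle : ∀ c S T, le S T → le (S.shift c) (T.shift c)) (c : Fin m ⊕ Fin n →₀ ℕ)
    {S T : ModTerm (Fin m ⊕ Fin n) r} (h : ExtLE W δ le S T) :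
    ExtLE W δ le (S.shift c) (T.shift c) := by
  unfold ExtLE
  rw [deg_shift, deg_shift, dehTerm_shift, dehTerm_shift, toLex_add, toLex_add]
  rcases h with h | ⟨h, h'⟩
  · exact Or.inl (by gcongr)
  · exact Or.inr ⟨by rw [h], hle _ _ _ h'⟩

/-- The extension of a monoid ordering by `W`: compare the degrees, then the dehomogenized power
products. (Power products are treated as the terms of the free module of rank one whose basis vector
has degree zero.) -/
def MonoidOrdering.extend (W : Matrix (Fin m) (Fin n) ℤ) (τ : MonoidOrdering (Fin n)) :
    MonoidOrdering (Fin m ⊕ Fin n) where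
  le a b := ExtLE (r := 1) W 0 (fun S T => τ.le S.2 T.2) (0, a) (0, b)
  trans _ _ _ h₁ h₂ := ExtLE.trans (le := fun S T => τ.le S.2 T.2)
    (fun S T U => τ.trans S.2 T.2 U.2) h₁ h₂
  antisymm _ _ h₁ h₂ := congrArg Prod.snd
    (ExtLE.antisymm (le := fun S T => τ.le S.2 T.2)
      (fun _ _ h h' => Prod.ext (Subsingleton.elim _ _) (τ.antisymm _ _ h h')) h₁ h₂)
  total _ _ := ExtLE.total (le := fun S T => τ.le S.2 T.2)
    (fun S T => τ.total S.2 T.2) _ _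
  mul_le c a b h := by
    have h' := ExtLE.shift (r := 1) (W := W) (δ := 0) (le := fun S T => τ.le S.2 T.2)
      (fun c S T => τ.mul_le c S.2 T.2) c h
    simpa only [ModTerm.shift] using h'

/-- The extension of a module ordering by `W`. -/
def ModuleOrdering.extend (W : Matrix (Fin m) (Fin n) ℤ) (δ : Fin r → Fin m → ℤ)
    (σ : ModuleOrdering (Fin n) r) : ModuleOrdering (Fin m ⊕ Fin n) r where
  le := ExtLE W δ σ.le
  trans _ _ _ h₁ h₂ := ExtLE.trans σ.trans h₁ h₂
  antisymm _ _ h₁ h₂ := ExtLE.antisymm σ.antisymm h₁ h₂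
  total S T := ExtLE.total σ.total S T
  mul_le c _ _ h := ExtLE.shift σ.mul_le c h
  compat := by
    obtain ⟨τ, hτ⟩ := σ.compat
    refine ⟨τ.extend W, fun a b h T => ?_⟩
    unfold ExtLE
    rw [deg_shift, deg_shift, dehTerm_shift, dehTerm_shift, toLex_add, toLex_add]
    have h : ExtLE (r := 1) W 0 (fun S T => τ.le S.2 T.2) (0, a) (0, b) := h
    simp only [ExtLE, deg, Pi.zero_apply, add_zero, dehTerm] at h
    rcases h with h | ⟨h, h'⟩
    · exact Or.inl (by gcongr)
    · exact Or.inr ⟨by rw [h], hτ _ _ h' _⟩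

/-- The vector `V` is homogeneous for the grading given by `(I_m | W)` and `δ`. -/
def IsHomogeneousVec (W : Matrix (Fin m) (Fin n) ℤ) (δ : Fin r → Fin m → ℤ)
    (V : FreeVec K (Fin m ⊕ Fin n) r) : Prop :=
  ∃ d : Fin m → ℤ, ∀ T ∈ supp V, deg (extMatrix W) δ T = d

/-- The top degree of a vector: the componentwise maximum of the degrees of the terms in its
support (zero for the zero vector). -/
noncomputable def topDeg (W : Matrix (Fin m) (Fin n) ℤ) (δ : Fin r → Fin m → ℤ)
    (v : FreeVec K (Fin n) r) (k : Fin m) : ℤ :=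
  open Classical in
  if h : (supp v).Nonempty then (supp v).sup' h (fun T => deg W δ T k) else 0

/-- The homogenization of a vector: each term `t e_i` in the support of `v`, of degree `τ`, is
multiplied by `y_1 ^ (μ_1 - τ_1) ⋯ y_m ^ (μ_m - τ_m)` where `μ` is the top degree of `v`. -/
noncomputable def homVec (W : Matrix (Fin m) (Fin n) ℤ) (δ : Fin r → Fin m → ℤ)
    (v : FreeVec K (Fin n) r) : FreeVec K (Fin m ⊕ Fin n) r :=
  fun i => ∑ t ∈ (v i).support, MvPolynomial.monomial
    (Finsupp.sumElim
      (Finsupp.equivFunOnFinite.symm fun k => (topDeg W δ v k - deg W δ (i, t) k).toNat) t)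
    (MvPolynomial.coeff t (v i))

/-- The dehomogenization of a vector: substitute `1` for each `y_k`. -/
noncomputable def dehVec (V : FreeVec K (Fin m ⊕ Fin n) r) : FreeVec K (Fin n) r :=
  fun i => MvPolynomial.aeval (Sum.elim (fun _ => 1) MvPolynomial.X) (V i)

/-- The saturation of a homogeneous vector. -/
noncomputable def satVec (W : Matrix (Fin m) (Fin n) ℤ) (δ : Fin r → Fin m → ℤ)
    (V : FreeVec K (Fin m ⊕ Fin n) r) : FreeVec K (Fin m ⊕ Fin n) r :=
  homVec W δ (dehVec V)

/-- `R'` is a homogeneous vector with the same saturation as `R`. -/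
def SatSubst (W : Matrix (Fin m) (Fin n) ℤ) (δ : Fin r → Fin m → ℤ)
    (R R' : FreeVec K (Fin m ⊕ Fin n) r) : Prop :=
  IsHomogeneousVec W δ R' ∧ satVec W δ R' = satVec W δ R

end Homogenization

/-! ## The weak self-saturating Buchberger algorithm, as a nondeterministic machine -/

section Algorithm

variable {K : Type*} [Field K] {m n r : ℕ}

/-- A state of the algorithm: the generators not yet treated, the pairs not yet treated, the tuple
`𝒢` under construction, and the vector whose weak saturating remainder is being computed, if
any. -/
structure State (K : Type*) [Field K] (m n r : ℕ) where
  gens : Multiset (FreeVec K (Fin m ⊕ Fin n) r)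
  pairs : Multiset (FreeVec K (Fin m ⊕ Fin n) r × FreeVec K (Fin m ⊕ Fin n) r)
  basis : Multiset (FreeVec K (Fin m ⊕ Fin n) r)
  current : Option (FreeVec K (Fin m ⊕ Fin n) r)

open Classical in
/-- The new pairs created by `V`: all pairs `(V, U)` with `U ∈ G` that have an S-vector, that is,
whose leading terms lie in the same component. -/
noncomputable def newPairs [NeZero r] (σ : ModuleOrdering (Fin m ⊕ Fin n) r)
    (V : FreeVec K (Fin m ⊕ Fin n) r) (G : Multiset (FreeVec K (Fin m ⊕ Fin n) r)) :
    Multiset (FreeVec K (Fin m ⊕ Fin n) r × FreeVec K (Fin m ⊕ Fin n) r) :=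
  (G.filter fun U => (leadTerm σ U).1 = (leadTerm σ V).1).map fun U => (V, U)

/-- The elementary steps of all weak self-saturating Buchberger algorithms, for the extension of `σ`
by `W`. -/
inductive Step [NeZero r] (W : Matrix (Fin m) (Fin n) ℤ) (δ : Fin r → Fin m → ℤ)
    (σ : ModuleOrdering (Fin n) r) : State K m n r → State K m n r → Prop
  /-- Choose a generator and remove it from the list of generators. -/
  | chooseGen (U gens pairs G) :
      Step W δ σ ⟨U ::ₘ gens, pairs, G, none⟩ ⟨gens, pairs, G, some U⟩
  /-- Choose a pair, remove it from the list of pairs and form its S-vector. -/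
  | choosePair (U V gens pairs G) :
      Step W δ σ ⟨gens, (U, V) ::ₘ pairs, G, none⟩
        ⟨gens, pairs, G, some (sVector (σ.extend W δ) U V)⟩
  /-- Replace the current remainder by a homogeneous vector with the same saturation (possibly by
  itself), and perform one step of the division algorithm. -/
  | reduce (gens pairs G R R' R'') (hsat : SatSubst W δ R R')
      (hdiv : DivisionStep (σ.extend W δ) G R' R'') :
      Step W δ σ ⟨gens, pairs, G, some R⟩ ⟨gens, pairs, G, some R''⟩
  /-- After a last replacement, the remainder is zero: nothing is added. -/
  | finishZero (gens pairs G R) (hsat : SatSubst W δ R 0) :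
      Step W δ σ ⟨gens, pairs, G, some R⟩ ⟨gens, pairs, G, none⟩
  /-- After a last replacement, the remainder `V` is not zero and its leading term is not divisible
  by the leading term of any element of `𝒢`: add `V` to `𝒢` and add the new pairs. -/
  | finishNonzero (gens pairs G R V) (hsat : SatSubst W δ R V) (hV : V ≠ 0)
      (hirr : ∀ U ∈ G, ¬ (leadTerm (σ.extend W δ) U).Dvd (leadTerm (σ.extend W δ) V)) :
      Step W δ σ ⟨gens, pairs, G, some R⟩
        ⟨gens, pairs + newPairs (σ.extend W δ) V G, V ::ₘ G, none⟩

/-- The initial state for the input `U_1, …, U_s`. -/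
def initState {s : ℕ} (U : Fin s → FreeVec K (Fin m ⊕ Fin n) r) : State K m n r :=
  ⟨Multiset.ofList (List.ofFn U), 0, 0, none⟩

/-- The state in which the algorithm stops and returns `G`. -/
def finalState (G : Multiset (FreeVec K (Fin m ⊕ Fin n) r)) : State K m n r :=
  ⟨0, 0, G, none⟩

/-- The state `S` is reached by some run on the input `U_1, …, U_s`. -/
def Reachable [NeZero r] (W : Matrix (Fin m) (Fin n) ℤ) (δ : Fin r → Fin m → ℤ)
    (σ : ModuleOrdering (Fin n) r) {s : ℕ} (U : Fin s → FreeVec K (Fin m ⊕ Fin n) r)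
    (S : State K m n r) : Prop :=
  Relation.ReflTransGen (Step W δ σ) (initState U) S

/-- `G` is the output of some run of a weak self-saturating Buchberger algorithm on the input
`U_1, …, U_s`. -/
def IsOutput [NeZero r] (W : Matrix (Fin m) (Fin n) ℤ) (δ : Fin r → Fin m → ℤ)
    (σ : ModuleOrdering (Fin n) r) {s : ℕ} (U : Fin s → FreeVec K (Fin m ⊕ Fin n) r)
    (G : Multiset (FreeVec K (Fin m ⊕ Fin n) r)) : Prop :=
  Reachable W δ σ U (finalState G)

/-- There is no infinite run on the input `U_1, …, U_s`, and no run gets stuck in a state that is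
not final; so each run can be continued until it stops with an output, and must eventually stop. -/
def AlwaysTerminates [NeZero r] (W : Matrix (Fin m) (Fin n) ℤ) (δ : Fin r → Fin m → ℤ)
    (σ : ModuleOrdering (Fin n) r) {s : ℕ} (U : Fin s → FreeVec K (Fin m ⊕ Fin n) r) : Prop :=
  (¬ ∃ f : ℕ → State K m n r, f 0 = initState U ∧ ∀ k, Step W δ σ (f k) (f (k + 1))) ∧
    ∀ S : State K m n r, Reachable W δ σ U S →
      (∃ G, S = finalState G) ∨ ∃ S', Step W δ σ S S'

end Algorithm

end SelfSat

namespace SelfSat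

/-! ## Terms and vectors -/

section Basic

variable {K : Type*} [Field K] {ι : Type} {r : ℕ}

/-! The proof watches a run through dehomogenization. The terms of a homogeneous vector have the
same degree, and the block $I_m$ of $\overline W$ then recovers the exponents of the $y_k$ from the
rest. So dehomogenization merges no two terms of such a vector, keeps coefficients and sends its
$\overline\sigma$-leading term to the $\sigma$-leading term of the image. Hence S-vectors go to
S-vectors and division steps to division steps, while replacing a vector by one with the same
saturation changes nothing downstairs. The image of a run is thus a Buchberger computation in $F$,
and when it stops every S-vector of the dehomogenized basis has a standard representation: a sum of
multiples $c\,x^a g$ whose leading terms lie strictly below the lcm (`Invariant.step`).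

It remains to prove Buchberger's criterion for a $\sigma$ that need not be well-founded
(`exists_leadTerm_dvd_of_sVector_mem`). Suppose that $\mathrm{LT}(f)$ is divisible by no
$\mathrm{LT}(g_i)$. Let $Q$ be the set of coefficient vectors $q$ with $\sum q_i g_i = uf$, where
$u$ has constant term $1$ and no term above $1$. As $uf$ and $f$ have the same leading term, the top
terms of the $q_ig_i$ must cancel, and lifted S-vectors lower $q$ in the Schreyer order. That every
element of $Q$ can be lowered is no contradiction by itself. However, $Q$ is also closed under $q -
c\,x^a q'$ for $x^a<1$, so Mora's reduction with écart applies: it keeps the total degree bounded,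
where only finitely many terms exist (`not_nonempty_of_descent`).

Termination combines two levels. Upstairs, each new basis element enlarges the monomodule of leading
terms, which Dickson's lemma allows only finitely often. Downstairs, division steps decrease the
support for the well-founded $\sigma$. -/

@[simp] theorem ModTerm.shift_fst (c : ι →₀ ℕ) (T : ModTerm ι r) : (T.shift c).1 = T.1 := rfl

@[simp] theorem ModTerm.shift_snd (c : ι →₀ ℕ) (T : ModTerm ι r) : (T.shift c).2 = c + T.2 := rfl

@[simp] theorem ModTerm.shift_zero (T : ModTerm ι r) : T.shift 0 = T := by
  simp [ModTerm.shift]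

theorem ModTerm.shift_shift (a b : ι →₀ ℕ) (T : ModTerm ι r) :
    (T.shift a).shift b = T.shift (b + a) := by
  simp [ModTerm.shift, add_assoc]

theorem ModTerm.shift_injective (c : ι →₀ ℕ) :
    Function.Injective (ModTerm.shift (r := r) c) := by
  intro S T h
  have h1 := congrArg Prod.fst h
  have h2 := congrArg Prod.snd h
  exact Prod.ext h1 (add_left_cancel h2)

theorem ModTerm.dvd_iff {S T : ModTerm ι r} : S.Dvd T ↔ S.1 = T.1 ∧ S.2 ≤ T.2 := by
  constructor
  · rintro ⟨c, rfl⟩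
    exact ⟨rfl, le_add_self⟩
  · rintro ⟨h1, h2⟩
    exact ⟨T.2 - S.2, Prod.ext h1.symm (tsub_add_cancel_of_le h2).symm⟩

theorem ModTerm.Dvd.trans {S T U : ModTerm ι r} (h : S.Dvd T) (h' : T.Dvd U) : S.Dvd U := by
  rw [ModTerm.dvd_iff] at *
  exact ⟨h.1.trans h'.1, h.2.trans h'.2⟩

/-- Dickson's lemma for module terms. -/
theorem ModTerm.exists_dvd [Finite ι] (f : ℕ → ModTerm ι r) :
    ∃ i j, i < j ∧ (f i).Dvd (f j) := by
  have h := WellQuasiOrdered.prod (Finite.wellQuasiOrdered (α := Fin r) (· = ·))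
    (wellQuasiOrdered_le (α := ι →₀ ℕ))
  obtain ⟨i, j, hij, h⟩ := h f
  exact ⟨i, j, hij, ModTerm.dvd_iff.2 h⟩

/-- The coefficient of a term in a vector. -/
def termCoeff (v : FreeVec K ι r) (T : ModTerm ι r) : K := MvPolynomial.coeff T.2 (v T.1)

theorem mem_supp_iff {v : FreeVec K ι r} {T : ModTerm ι r} : T ∈ supp v ↔ termCoeff v T ≠ 0 :=
  mem_supp v T

theorem notMem_supp_iff {v : FreeVec K ι r} {T : ModTerm ι r} : T ∉ supp v ↔ termCoeff v T = 0 := by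
  rw [mem_supp_iff, not_not]

@[simp] theorem termCoeff_zero (T : ModTerm ι r) : termCoeff (0 : FreeVec K ι r) T = 0 := by
  simp [termCoeff]

@[simp] theorem termCoeff_add (u v : FreeVec K ι r) (T : ModTerm ι r) :
    termCoeff (u + v) T = termCoeff u T + termCoeff v T := by
  simp [termCoeff]

@[simp] theorem termCoeff_sub (u v : FreeVec K ι r) (T : ModTerm ι r) :
    termCoeff (u - v) T = termCoeff u T - termCoeff v T := by
  simp [termCoeff]

@[simp] theorem termCoeff_neg (v : FreeVec K ι r) (T : ModTerm ι r) :
    termCoeff (-v) T = -termCoeff v T := by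
  simp [termCoeff]

theorem termCoeff_sum {α : Type*} (s : Finset α) (f : α → FreeVec K ι r) (T : ModTerm ι r) :
    termCoeff (∑ x ∈ s, f x) T = ∑ x ∈ s, termCoeff (f x) T := by
  simp [termCoeff, MvPolynomial.coeff_sum]

@[simp] theorem termCoeff_monomial_smul_shift (a : ι →₀ ℕ) (c : K) (v : FreeVec K ι r)
    (T : ModTerm ι r) :
    termCoeff (MvPolynomial.monomial a c • v) (T.shift a) = c * termCoeff v T := by
  simp [termCoeff, MvPolynomial.coeff_monomial_mul]

theorem exists_of_mem_supp_monomial_smul {a : ι →₀ ℕ} {c : K} {v : FreeVec K ι r}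
    {T : ModTerm ι r} (h : T ∈ supp (MvPolynomial.monomial a c • v)) :
    ∃ S ∈ supp v, T = S.shift a := by
  classical
  rw [mem_supp_iff, termCoeff, Pi.smul_apply, smul_eq_mul, MvPolynomial.coeff_monomial_mul'] at h
  split_ifs at h with ha
  · refine ⟨(T.1, T.2 - a), ?_, Prod.ext rfl (add_tsub_cancel_of_le ha).symm⟩
    exact mem_supp_iff.2 (right_ne_zero_of_mul h)
  · exact absurd rfl h

theorem mem_supp_or_of_mem_supp_sub {u v : FreeVec K ι r} {T : ModTerm ι r}
    (h : T ∈ supp (u - v)) : T ∈ supp u ∨ T ∈ supp v := by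
  by_contra! h'
  rw [notMem_supp_iff, notMem_supp_iff] at h'
  exact mem_supp_iff.1 h (by simp [h'.1, h'.2])

theorem mem_supp_or_of_mem_supp_add {u v : FreeVec K ι r} {T : ModTerm ι r}
    (h : T ∈ supp (u + v)) : T ∈ supp u ∨ T ∈ supp v := by
  by_contra! h'
  rw [notMem_supp_iff, notMem_supp_iff] at h'
  exact mem_supp_iff.1 h (by simp [h'.1, h'.2])

theorem supp_neg (v : FreeVec K ι r) : supp (-v) = supp v := by
  ext T; simp [mem_supp_iff]

@[simp] theorem supp_zero : supp (0 : FreeVec K ι r) = ∅ := by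
  ext T; simp [mem_supp_iff]

theorem ne_zero_of_mem_supp {v : FreeVec K ι r} {T : ModTerm ι r} (h : T ∈ supp v) : v ≠ 0 := by
  rintro rfl
  simp at h

theorem sum_supp {M : Type*} [AddCommMonoid M] (v : FreeVec K ι r) (f : ModTerm ι r → M) :
    ∑ T ∈ supp v, f T = ∑ i, ∑ t ∈ (v i).support, f (i, t) := by
  classical
  have h : supp v = Finset.univ.biUnion fun i => (v i).support.image (Prod.mk i) := by
    ext T; simp [mem_supp_iff, termCoeff, Prod.ext_iff]
  rw [h, Finset.sum_biUnion]
  · refine Finset.sum_congr rfl fun i _ => ?_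
    rw [Finset.sum_image]
    intro a _ b _ h
    exact (Prod.mk.inj h).2
  · intro i _ j _ hij
    rw [Function.onFun, Finset.disjoint_left]
    intro T hT hT'
    obtain ⟨a, _, rfl⟩ := Finset.mem_image.1 hT
    obtain ⟨b, _, h⟩ := Finset.mem_image.1 hT'
    exact hij (Prod.mk.inj h).1.symm

theorem sum_smul_eq_sum_supp {M : Type*} [AddCommGroup M] [Module (MvPolynomial ι K) M]
    (q : FreeVec K ι r) (g : Fin r → M) :
    ∑ i, q i • g i = ∑ B ∈ supp q, MvPolynomial.monomial B.2 (termCoeff q B) • g B.1 := by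
  rw [sum_supp]
  refine Finset.sum_congr rfl fun i _ => ?_
  change _ = ∑ t ∈ (q i).support, MvPolynomial.monomial t (MvPolynomial.coeff t (q i)) • g i
  rw [← Finset.sum_smul, MvPolynomial.support_sum_monomial_coeff]

end Basic

/-! ## The strict order of a module ordering, and leading terms -/

section Orderings

variable {K : Type*} [Field K] {ι : Type} {r : ℕ} (σ : ModuleOrdering ι r)

theorem ModuleOrdering.refl (T : ModTerm ι r) : σ.le T T := (σ.total T T).elim id id

/-- The strict order of a module ordering. -/
def ModuleOrdering.lt (S T : ModTerm ι r) : Prop := σ.le S T ∧ S ≠ T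

variable {σ}

theorem ModuleOrdering.lt.le {S T : ModTerm ι r} (h : σ.lt S T) : σ.le S T := h.1

theorem ModuleOrdering.lt_of_le_of_lt {S T U : ModTerm ι r} (h : σ.le S T) (h' : σ.lt T U) :
    σ.lt S U :=
  ⟨σ.trans _ _ _ h h'.1, fun e => h'.2 (σ.antisymm _ _ h'.1 (e ▸ h))⟩

theorem ModuleOrdering.lt_of_lt_of_le {S T U : ModTerm ι r} (h : σ.lt S T) (h' : σ.le T U) :
    σ.lt S U :=
  ⟨σ.trans _ _ _ h.1 h', fun e => h.2 (σ.antisymm _ _ h.1 (e ▸ h'))⟩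

theorem ModuleOrdering.lt_irrefl (T : ModTerm ι r) : ¬ σ.lt T T := fun h => h.2 rfl

theorem ModuleOrdering.lt_or_le (S T : ModTerm ι r) : σ.lt S T ∨ σ.le T S := by
  by_cases h : σ.le T S
  · exact Or.inr h
  · exact Or.inl ⟨(σ.total S T).resolve_right h, fun e => h (e ▸ σ.refl T)⟩

theorem ModuleOrdering.lt.shift {S T : ModTerm ι r} (h : σ.lt S T) (c : ι →₀ ℕ) :
    σ.lt (S.shift c) (T.shift c) :=
  ⟨σ.mul_le _ _ _ h.1, fun e => h.2 (ModTerm.shift_injective c e)⟩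

variable (σ) in
theorem ModuleOrdering.isStrictOrder : IsStrictOrder (ModTerm ι r) σ.lt where
  irrefl := ModuleOrdering.lt_irrefl
  trans _ _ _ h h' := ModuleOrdering.lt_of_lt_of_le h h'.1

theorem IsLeadTerm.eq {v : FreeVec K ι r} {S T : ModTerm ι r} (h : IsLeadTerm σ v S)
    (h' : IsLeadTerm σ v T) : S = T :=
  σ.antisymm _ _ (h'.2 _ h.1) (h.2 _ h'.1)

theorem leadTerm_eq [NeZero r] {v : FreeVec K ι r} {T : ModTerm ι r} (h : IsLeadTerm σ v T) :
    leadTerm σ v = T :=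
  (leadTerm_spec σ (ne_zero_of_mem_supp h.1)).eq h

theorem leadTerm_mem [NeZero r] (σ : ModuleOrdering ι r) {v : FreeVec K ι r} (hv : v ≠ 0) :
    leadTerm σ v ∈ supp v :=
  (leadTerm_spec σ hv).1

theorem le_leadTerm [NeZero r] (σ : ModuleOrdering ι r) {v : FreeVec K ι r} {T : ModTerm ι r}
    (h : T ∈ supp v) : σ.le T (leadTerm σ v) :=
  (leadTerm_spec σ (ne_zero_of_mem_supp h)).2 _ h

theorem leadCoeff_eq [NeZero r] (σ : ModuleOrdering ι r) (v : FreeVec K ι r) :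
    leadCoeff σ v = termCoeff v (leadTerm σ v) := rfl

theorem leadCoeff_ne_zero [NeZero r] (σ : ModuleOrdering ι r) {v : FreeVec K ι r} (hv : v ≠ 0) :
    leadCoeff σ v ≠ 0 :=
  mem_supp_iff.1 (leadTerm_mem σ hv)

/-- The strict order of a module term ordering is well-founded. -/
theorem ModuleOrdering.IsTermOrdering.wellFounded_lt [Finite ι] (hσ : σ.IsTermOrdering) :
    WellFounded σ.lt := by
  refine wellFounded_iff_isEmpty_descending_chain.2 ⟨fun ⟨f, hf⟩ => ?_⟩
  have hanti : ∀ i k, σ.lt (f (i + k + 1)) (f i) := by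
    intro i k
    induction k with
    | zero => exact hf i
    | succ k ih => exact ModuleOrdering.lt_of_lt_of_le (hf _) ih.le
  -- By Dickson's lemma some term of the chain divides a later one, so it cannot be larger.
  obtain ⟨i, j, hij, c, hc⟩ := ModTerm.exists_dvd f
  obtain ⟨k, rfl⟩ := Nat.exists_eq_add_of_lt hij
  have h := hσ c (f i)
  rw [← hc] at h
  exact ModuleOrdering.lt_irrefl _ (ModuleOrdering.lt_of_le_of_lt h (hanti i k))

end Orderings

/-! ## A descent principle for orderings that need not be well-founded -/

section Descent

variable {K : Type*} [Field K] {ι : Type} {s : ℕ}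

/-- A family of keys in a well-quasi-order is bounded below by finitely many of its members. -/
theorem exists_finset_forall_exists_le {α β : Type*} [LE β] [WellQuasiOrderedLE β] (Q : Set α)
    (key : α → β) : ∃ F : Finset α, (∀ p ∈ F, p ∈ Q) ∧ ∀ q ∈ Q, ∃ p ∈ F, key p ≤ key q := by
  by_contra! h
  obtain ⟨f, -, hf⟩ := exists_seq_of_forall_finset_exists (· ∈ Q)
    (fun x y => ¬ key x ≤ key y) h
  obtain ⟨i, j, hij, hle⟩ := wellQuasiOrdered_le (key ∘ f)
  exact hf i j hij hle

/-- The total degree of a vector. -/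
noncomputable def totalDeg (v : FreeVec K ι s) : ℕ := (supp v).sup fun T => T.2.degree

theorem degree_le_totalDeg {v : FreeVec K ι s} {T : ModTerm ι s} (h : T ∈ supp v) :
    T.2.degree ≤ totalDeg v :=
  Finset.le_sup (f := fun T : ModTerm ι s => T.2.degree) h

theorem finite_setOf_degree_le [Finite ι] (d : ℕ) :
    {T : ModTerm ι s | T.2.degree ≤ d}.Finite :=
  (Set.finite_univ.prod (Finsupp.finite_of_degree_le (σ := ι) d)).subset
    fun _ hT => ⟨Set.mem_univ _, hT⟩

/-- Since the order is total, it suffices to undercut the smallest leading term occurring in `F`. -/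
theorem exists_mem_forall_leadTerm_lt [NeZero s] {σ : ModuleOrdering ι s}
    {Q : Set (FreeVec K ι s)}
    (hQ : Q.Nonempty) (hdesc : ∀ q ∈ Q, ∃ q' ∈ Q, σ.lt (leadTerm σ q') (leadTerm σ q))
    (F : Finset (FreeVec K ι s)) (hF : ∀ p ∈ F, p ∈ Q) :
    ∃ q ∈ Q, ∀ p ∈ F, σ.lt (leadTerm σ q) (leadTerm σ p) := by
  classical
  induction F using Finset.induction_on with
  | empty =>
    obtain ⟨q, hq⟩ := hQ
    exact ⟨q, hq, by simp⟩
  | insert a F ha ih =>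
    obtain ⟨q, hq, hlt⟩ := ih fun p hp => hF p (Finset.mem_insert_of_mem hp)
    obtain ⟨a', ha', hlt'⟩ := hdesc a (hF a (Finset.mem_insert_self a F))
    rcases σ.lt_or_le (leadTerm σ q) (leadTerm σ a) with h | h
    · refine ⟨q, hq, fun p hp => ?_⟩
      rcases Finset.mem_insert.1 hp with rfl | hp
      · exact h
      · exact hlt p hp
    · refine ⟨a', ha', fun p hp => ?_⟩
      rcases Finset.mem_insert.1 hp with rfl | hp
      · exact hlt'
      · exact ModuleOrdering.lt_of_lt_of_le hlt' (σ.trans _ _ _ h (hlt p hp).le)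

/-- A non-empty set of non-zero vectors cannot be closed both under lowering the leading term and
under subtracting multiples by power products smaller than `1`. -/
theorem not_nonempty_of_descent [Finite ι] [NeZero s] {σ : ModuleOrdering ι s}
    {τ : MonoidOrdering ι}
    (hτ : ∀ a b, τ.le a b → ∀ T : ModTerm ι s, σ.le (T.shift a) (T.shift b))
    {Q : Set (FreeVec K ι s)} (hne : ∀ q ∈ Q, q ≠ 0)
    (hsub : ∀ q ∈ Q, ∀ q' ∈ Q, ∀ a, τ.le a 0 → a ≠ 0 → ∀ c : K,
      q - MvPolynomial.monomial a c • q' ∈ Q)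
    (hdesc : ∀ q ∈ Q, ∃ q' ∈ Q, σ.lt (leadTerm σ q') (leadTerm σ q)) : ¬ Q.Nonempty := by
  intro hQ
  have := Finite.to_wellQuasiOrderedLE (α := Fin s)
  -- Mora's écart. The subtraction never truncates, since the leading term belongs to the support.
  let e : FreeVec K ι s → ℕ := fun q => totalDeg q - (leadTerm σ q).2.degree
  obtain ⟨F, hFQ, hF⟩ : ∃ F : Finset (FreeVec K ι s), (∀ p ∈ F, p ∈ Q) ∧
      ∀ q ∈ Q, ∃ p ∈ F, (leadTerm σ p).Dvd (leadTerm σ q) ∧ e p ≤ e q := by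
    -- Dickson's lemma with the écart as an extra coordinate. The component `i` is encoded as
    -- `single i 1`, so that comparability forces equal components.
    obtain ⟨F, hFQ, hF⟩ : ∃ F : Finset (FreeVec K ι s), (∀ p ∈ F, p ∈ Q) ∧ ∀ q ∈ Q, ∃ p ∈ F,
        ((Finsupp.single (leadTerm σ p).1 1, (leadTerm σ p).2, e p) : (Fin s →₀ ℕ) × _ × ℕ) ≤
          (Finsupp.single (leadTerm σ q).1 1, (leadTerm σ q).2, e q) :=
      exists_finset_forall_exists_le Q _
    refine ⟨F, hFQ, fun q hq => ?_⟩
    obtain ⟨p, hp, h1, h2, h3⟩ := hF q hq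
    refine ⟨p, hp, ModTerm.dvd_iff.2 ⟨?_, h2⟩, h3⟩
    by_contra hne'
    have := h1 (leadTerm σ p).1
    simp [Ne.symm hne'] at this
  -- Starting below all leading terms of `F` ensures that every quotient `LT(q) / LT(p)` met in the
  -- reduction is smaller than `1`, as `hsub` requires.
  obtain ⟨q₀, hq₀, hlt₀⟩ := exists_mem_forall_leadTerm_lt hQ hdesc F hFQ
  let B : Set (ModTerm ι s) := {T | T.2.degree ≤ totalDeg q₀}
  have := σ.isStrictOrder
  have hwf : B.WellFoundedOn σ.lt := (finite_setOf_degree_le _).wellFoundedOn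
  have key : ∀ T ∈ B, ∀ q ∈ Q, leadTerm σ q = T → totalDeg q ≤ totalDeg q₀ →
      σ.le T (leadTerm σ q₀) → False := by
    intro T hT
    refine hwf.induction (P := fun T => ∀ q ∈ Q, leadTerm σ q = T → totalDeg q ≤ totalDeg q₀ →
      σ.le T (leadTerm σ q₀) → False) hT fun T hT ih => ?_
    rintro q hq rfl hdeg hle
    obtain ⟨p, hp, ⟨a, ha⟩, he⟩ := hF q hq
    have hlt : σ.lt (leadTerm σ q) (leadTerm σ p) :=
      ModuleOrdering.lt_of_le_of_lt hle (hlt₀ p hp)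
    have ha0 : a ≠ 0 := by
      rintro rfl
      rw [ModTerm.shift_zero] at ha
      exact hlt.2 ha
    have haτ : τ.le a 0 := by
      refine (τ.total a 0).resolve_right fun h => ?_
      have := hτ _ _ h (leadTerm σ p)
      rw [ModTerm.shift_zero, ← ha] at this
      exact ModuleOrdering.lt_irrefl _ (ModuleOrdering.lt_of_le_of_lt this hlt)
    set c : K := leadCoeff σ q / leadCoeff σ p with hc
    set q' := q - MvPolynomial.monomial a c • p with hq'
    have hq'Q : q' ∈ Q := hsub q hq p (hFQ p hp) a haτ ha0 c
    have hq'0 : q' ≠ 0 := hne _ hq'Q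
    have hp0 := hne p (hFQ p hp)
    have hle' : ∀ S ∈ supp q', σ.le S (leadTerm σ q) ∧ S.2.degree ≤ totalDeg q := by
      intro S hS
      rcases mem_supp_or_of_mem_supp_sub hS with hS | hS
      · exact ⟨le_leadTerm σ hS, degree_le_totalDeg hS⟩
      · obtain ⟨S, hS', rfl⟩ := exists_of_mem_supp_monomial_smul hS
        refine ⟨ha ▸ σ.mul_le _ _ _ (le_leadTerm σ hS'), ?_⟩
        -- The degree of `x^a p` is at most `deg LT(q) + e p`, and `e p ≤ e q` bounds this by the
        -- total degree of `q`.
        have h1 := degree_le_totalDeg hS'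
        have h2 := degree_le_totalDeg (leadTerm_mem σ hp0)
        have h3 := degree_le_totalDeg (leadTerm_mem σ (hne q hq))
        have h4 : (leadTerm σ q).2.degree = a.degree + (leadTerm σ p).2.degree := by
          rw [ha, ModTerm.shift_snd, map_add]
        simp only [e] at he
        rw [ModTerm.shift_snd, map_add]
        omega
    have hcoeff : termCoeff q' (leadTerm σ q) = 0 := by
      rw [hq', termCoeff_sub]
      nth_rewrite 2 [ha]
      rw [termCoeff_monomial_smul_shift, hc, ← leadCoeff_eq, ← leadCoeff_eq,
        div_mul_cancel₀ _ (leadCoeff_ne_zero σ hp0), sub_self]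
    have hlt' : σ.lt (leadTerm σ q') (leadTerm σ q) := by
      refine ⟨(hle' _ (leadTerm_mem σ hq'0)).1, fun h => ?_⟩
      exact mem_supp_iff.1 (leadTerm_mem σ hq'0) (h ▸ hcoeff)
    have hdeg' : totalDeg q' ≤ totalDeg q₀ :=
      (Finset.sup_le fun S hS => (hle' S hS).2).trans hdeg
    exact ih _ ((degree_le_totalDeg (leadTerm_mem σ hq'0)).trans hdeg') hlt' q' hq'Q rfl hdeg'
      (σ.trans _ _ _ hlt'.le hle)
  exact key _ (degree_le_totalDeg (leadTerm_mem σ (hne q₀ hq₀))) q₀ hq₀ rfl le_rfl (σ.refl _)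

end Descent

/-! ## Buchberger's criterion for arbitrary module orderings -/

section Criterion

variable {K : Type*} [Field K] {ι : Type} {r s : ℕ}

/-- The ordering on the terms of the free module of rank `s` induced by terms `L 1, …, L s`:
compare `t L_i` by `σ`, and break ties by the index. -/
noncomputable def ModuleOrdering.schreyer (σ : ModuleOrdering ι r) (L : Fin s → ModTerm ι r) :
    ModuleOrdering ι s where
  le S T := σ.lt ((L S.1).shift S.2) ((L T.1).shift T.2) ∨
    (L S.1).shift S.2 = (L T.1).shift T.2 ∧ S.1 ≤ T.1
  trans S T U h h' := by
    rcases h with h | ⟨h, h1⟩ <;> rcases h' with h' | ⟨h', h1'⟩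
    · exact Or.inl (ModuleOrdering.lt_of_lt_of_le h h'.1)
    · exact Or.inl (h' ▸ h)
    · exact Or.inl (h ▸ h')
    · exact Or.inr ⟨h.trans h', h1.trans h1'⟩
  antisymm S T h h' := by
    rcases h with h | ⟨h, h1⟩ <;> rcases h' with h' | ⟨h', h1'⟩
    · exact absurd (ModuleOrdering.lt_of_lt_of_le h h'.1) (ModuleOrdering.lt_irrefl _)
    · exact absurd h'.symm h.2
    · exact absurd h.symm h'.2
    · have h2 := le_antisymm h1 h1'
      refine Prod.ext h2 ?_
      rw [h2] at h
      exact add_right_cancel (congrArg Prod.snd h)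
  total S T := by
    rcases σ.lt_or_le ((L S.1).shift S.2) ((L T.1).shift T.2) with h | h
    · exact Or.inl (Or.inl h)
    · by_cases h' : (L S.1).shift S.2 = (L T.1).shift T.2
      · exact (le_total S.1 T.1).imp (fun h1 => Or.inr ⟨h', h1⟩) fun h1 => Or.inr ⟨h'.symm, h1⟩
      · exact Or.inr (Or.inl ⟨h, Ne.symm h'⟩)
  mul_le c S T h := by
    simp only [ModTerm.shift_fst, ModTerm.shift_snd, ← ModTerm.shift_shift]
    exact h.imp (fun h => h.shift c) fun h => ⟨by rw [h.1], h.2⟩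
  compat := by
    obtain ⟨τ, hτ⟩ := σ.compat
    refine ⟨τ, fun a b h T => ?_⟩
    simp only [ModTerm.shift_fst, ModTerm.shift_snd, ← ModTerm.shift_shift]
    by_cases h' : (((L T.1).shift T.2).shift a) = (((L T.1).shift T.2).shift b)
    · exact Or.inr ⟨h', le_rfl⟩
    · exact Or.inl ⟨hτ a b h _, h'⟩

theorem sum_single_smul (g : Fin s → FreeVec K ι r) (i : Fin s) (f : MvPolynomial ι K) :
    ∑ k, (Pi.single i f : FreeVec K ι s) k • g k = f • g i := by
  rw [Finset.sum_eq_single i (fun j _ hj => by rw [Pi.single_eq_of_ne hj, zero_smul]) (by simp),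
    Pi.single_eq_same]

theorem eq_of_mem_supp_single_monomial {i : Fin s} {a : ι →₀ ℕ} {c : K} {B : ModTerm ι s}
    (hB : B ∈ supp (Pi.single i (MvPolynomial.monomial a c) : FreeVec K ι s)) : B = (i, a) := by
  classical
  obtain ⟨k, b⟩ := B
  rw [mem_supp_iff, termCoeff] at hB
  by_cases hk : k = i
  · subst hk
    rw [Pi.single_eq_same, MvPolynomial.coeff_monomial] at hB
    split_ifs at hB with hab
    · rw [hab]
    · exact absurd rfl hB
  · simp [Pi.single_eq_of_ne hk] at hB

/-- Multiplication by a polynomial with leading term `1` preserves leading terms. -/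
theorem IsLeadTerm.unit_smul {σ : ModuleOrdering ι r} {τ : MonoidOrdering ι}
    (hτ : ∀ a b, τ.le a b → ∀ T : ModTerm ι r, σ.le (T.shift a) (T.shift b))
    {u : MvPolynomial ι K} (hu : MvPolynomial.coeff 0 u = 1) (hu' : ∀ a ∈ u.support, τ.le a 0)
    {f : FreeVec K ι r} {T : ModTerm ι r} (h : IsLeadTerm σ f T) : IsLeadTerm σ (u • f) T := by
  classical
  have hsum : u • f = ∑ a ∈ u.support, MvPolynomial.monomial a (MvPolynomial.coeff a u) • f := by
    rw [← Finset.sum_smul, MvPolynomial.support_sum_monomial_coeff]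
  have hle : ∀ a ∈ u.support, ∀ S ∈ supp f, σ.le (S.shift a) S := fun a ha S _ => by
    simpa using hτ a 0 (hu' a ha) S
  constructor
  · rw [mem_supp_iff, hsum, termCoeff_sum, Finset.sum_eq_single 0]
    · have h1 := termCoeff_monomial_smul_shift 0 (MvPolynomial.coeff 0 u) f T
      rw [ModTerm.shift_zero, hu, one_mul] at h1
      rw [hu, h1]
      exact mem_supp_iff.1 h.1
    · intro a ha ha0
      rw [← notMem_supp_iff]
      intro hT
      obtain ⟨S, hS, rfl⟩ := exists_of_mem_supp_monomial_smul hT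
      -- Here `T = x^a S ≤ S ≤ T`, so `S = T` and `a = 0`: only the constant term of `u` contributes
      -- to the coefficient of `T`.
      have h1 := σ.antisymm _ _ (hle a ha S hS) (h.2 S hS)
      have h2 := congrArg Prod.snd h1
      exact ha0 (by simpa using h2)
    · intro h0
      rw [MvPolynomial.notMem_support_iff, hu] at h0
      exact absurd h0 one_ne_zero
  · intro S hS
    rw [mem_supp_iff, hsum, termCoeff_sum] at hS
    obtain ⟨a, ha, hS⟩ := Finset.exists_ne_zero_of_sum_ne_zero hS
    obtain ⟨S, hS', rfl⟩ := exists_of_mem_supp_monomial_smul (mem_supp_iff.2 hS)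
    exact σ.trans _ _ _ (hle a ha S hS') (h.2 S hS')

variable [NeZero r] (σ : ModuleOrdering ι r)

/-- The combinations of the elements of `G` all of whose summands `c x^a g` have a leading term
smaller than `T`. -/
noncomputable def standardSpan (G : Set (FreeVec K ι r)) (T : ModTerm ι r) : AddSubgroup (FreeVec K ι r) :=
  AddSubgroup.closure {w | ∃ g ∈ G, ∃ (a : ι →₀ ℕ) (c : K),
    w = MvPolynomial.monomial a c • g ∧ σ.lt ((leadTerm σ g).shift a) T}

variable {σ}

theorem standardSpan_mono {G H : Set (FreeVec K ι r)} (h : G ⊆ H) (T : ModTerm ι r) :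
    standardSpan σ G T ≤ standardSpan σ H T :=
  AddSubgroup.closure_mono fun _ ⟨g, hg, ha⟩ => ⟨g, h hg, ha⟩

theorem monomial_smul_mem_standardSpan {G : Set (FreeVec K ι r)} {T : ModTerm ι r}
    {g : FreeVec K ι r} (hg : g ∈ G) {a : ι →₀ ℕ} (c : K)
    (h : σ.lt ((leadTerm σ g).shift a) T) :
    MvPolynomial.monomial a c • g ∈ standardSpan σ G T :=
  AddSubgroup.subset_closure ⟨g, hg, a, c, rfl, h⟩

theorem exists_eq_sum_of_mem_standardSpan {g : Fin s → FreeVec K ι r} {T : ModTerm ι r}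
    {w : FreeVec K ι r} (h : w ∈ standardSpan σ (Set.range g) T) :
    ∃ p : FreeVec K ι s, ∑ i, p i • g i = w ∧
      ∀ B ∈ supp p, σ.lt ((leadTerm σ (g B.1)).shift B.2) T := by
  induction h using AddSubgroup.closure_induction with
  | mem w hw =>
    obtain ⟨_, ⟨i, rfl⟩, a, c, rfl, hlt⟩ := hw
    refine ⟨Pi.single i (MvPolynomial.monomial a c), sum_single_smul g i _, fun B hB => ?_⟩
    rw [eq_of_mem_supp_single_monomial hB]
    exact hlt
  | zero => exact ⟨0, by simp, by simp⟩
  | add u v _ _ hu hv =>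
    obtain ⟨p, rfl, hp⟩ := hu
    obtain ⟨q, rfl, hq⟩ := hv
    refine ⟨p + q, by simp [add_smul, Finset.sum_add_distrib], fun B hB => ?_⟩
    exact (mem_supp_or_of_mem_supp_add hB).elim (hp B) (hq B)
  | neg u _ hu =>
    obtain ⟨p, rfl, hp⟩ := hu
    exact ⟨-p, by simp, fun B hB => hp B (by rwa [supp_neg] at hB)⟩

/-- If the largest of the terms `t LT(g_i)`, for `t e_i` in the support of `q`, is attained only
once, then it is the leading term of `∑ q_i g_i`. -/
theorem isLeadTerm_sum_smul {g : Fin s → FreeVec K ι r} (hg : ∀ i, g i ≠ 0) {q : FreeVec K ι s}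
    {A : ModTerm ι s} (hA : A ∈ supp q) (h : ∀ B ∈ supp q, B ≠ A →
      σ.lt ((leadTerm σ (g B.1)).shift B.2) ((leadTerm σ (g A.1)).shift A.2)) :
    IsLeadTerm σ (∑ i, q i • g i) ((leadTerm σ (g A.1)).shift A.2) := by
  rw [sum_smul_eq_sum_supp]
  constructor
  · rw [mem_supp_iff, termCoeff_sum, Finset.sum_eq_single A]
    · rw [termCoeff_monomial_smul_shift]
      exact mul_ne_zero (mem_supp_iff.1 hA) (leadCoeff_ne_zero σ (hg _))
    · intro B hB hBA
      rw [← notMem_supp_iff]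
      intro hT
      obtain ⟨S, hS, hST⟩ := exists_of_mem_supp_monomial_smul hT
      have h1 := ModuleOrdering.lt_of_le_of_lt (σ.mul_le B.2 _ _ (le_leadTerm σ hS)) (h B hB hBA)
      rw [← hST] at h1
      exact ModuleOrdering.lt_irrefl _ h1
    · exact fun h => absurd hA h
  · intro S hS
    rw [mem_supp_iff, termCoeff_sum] at hS
    obtain ⟨B, hB, hS⟩ := Finset.exists_ne_zero_of_sum_ne_zero hS
    obtain ⟨S, hS', rfl⟩ := exists_of_mem_supp_monomial_smul (mem_supp_iff.2 hS)
    refine σ.trans _ _ _ (σ.mul_le _ _ _ (le_leadTerm σ hS')) ?_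
    by_cases hBA : B = A
    · rw [hBA]; exact σ.refl _
    · exact (h B hB hBA).le

/-- The least common multiple of the leading terms of two vectors (meaningful if these lie in the
same component). -/
noncomputable def lcmLead (σ : ModuleOrdering ι r) (u v : FreeVec K ι r) : ModTerm ι r :=
  ((leadTerm σ u).1, (leadTerm σ u).2 ⊔ (leadTerm σ v).2)

/-- The lifting of an S-vector that has a standard representation to a syzygy. -/
theorem exists_syzygy {g : Fin s → FreeVec K ι r} (hg : ∀ i, g i ≠ 0) {i j : Fin s} (hij : i ≠ j)
    (hS : sVector σ (g i) (g j) ∈ standardSpan σ (Set.range g) (lcmLead σ (g i) (g j))) :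
    ∃ z : FreeVec K ι s, ∑ k, z k • g k = 0 ∧
      termCoeff z (i, (lcmLead σ (g i) (g j)).2 - (leadTerm σ (g i)).2) ≠ 0 ∧
      ∀ B ∈ supp z, B ≠ (i, (lcmLead σ (g i) (g j)).2 - (leadTerm σ (g i)).2) →
        σ.lt ((leadTerm σ (g B.1)).shift B.2) (lcmLead σ (g i) (g j)) ∨
        B = (j, (lcmLead σ (g i) (g j)).2 - (leadTerm σ (g j)).2) := by
  classical
  obtain ⟨p, hp, hlt⟩ := exists_eq_sum_of_mem_standardSpan hS
  set T := lcmLead σ (g i) (g j) with hT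
  have hTi : (leadTerm σ (g i)).shift (T.2 - (leadTerm σ (g i)).2) = T :=
    Prod.ext rfl (tsub_add_cancel_of_le le_sup_left)
  -- The formal S-vector; subtracting the standard representation `p` makes it a syzygy.
  let z₀ : FreeVec K ι s :=
    Pi.single i (MvPolynomial.monomial (T.2 - (leadTerm σ (g i)).2) (leadCoeff σ (g i))⁻¹) -
      Pi.single j (MvPolynomial.monomial (T.2 - (leadTerm σ (g j)).2) (leadCoeff σ (g j))⁻¹)
  refine ⟨z₀ - p, ?_, ?_, fun B hB hBi => ?_⟩
  · simp only [Pi.sub_apply, sub_smul, Finset.sum_sub_distrib, z₀, sum_single_smul, hp]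
    rw [sub_eq_zero]
    rfl
  -- This position stands for a multiple of `g i` with leading term exactly the lcm, whereas `p`
  -- uses only multiples strictly below it.
  · have hp0 : termCoeff p (i, T.2 - (leadTerm σ (g i)).2) = 0 := by
      rw [← notMem_supp_iff]
      intro h
      have := hlt _ h
      rw [hTi] at this
      exact ModuleOrdering.lt_irrefl _ this
    rw [termCoeff_sub, hp0, sub_zero]
    simp [z₀, termCoeff, Pi.single_eq_of_ne hij, leadCoeff_ne_zero σ (hg i)]
  · rcases mem_supp_or_of_mem_supp_sub hB with hB | hB
    · rcases mem_supp_or_of_mem_supp_sub hB with hB | hB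
      · exact absurd (eq_of_mem_supp_single_monomial hB) hBi
      · exact Or.inr (eq_of_mem_supp_single_monomial hB)
    · exact Or.inl (hlt B hB)

/-- Buchberger's criterion: if all S-vectors have a standard representation, then the leading terms
of the generators generate the leading terms of the module. The ordering need not be well-founded. -/
theorem exists_leadTerm_dvd_of_sVector_mem [Finite ι] {g : Fin s → FreeVec K ι r}
    (hg : ∀ i, g i ≠ 0)
    (hS : ∀ i j, (leadTerm σ (g i)).1 = (leadTerm σ (g j)).1 →
      sVector σ (g i) (g j) ∈ standardSpan σ (Set.range g) (lcmLead σ (g i) (g j)))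
    {f : FreeVec K ι r} (hf : f ∈ Submodule.span (MvPolynomial ι K) (Set.range g)) (hf0 : f ≠ 0) :
    ∃ i, (leadTerm σ (g i)).Dvd (leadTerm σ f) := by
  by_contra! hnd
  obtain ⟨q₁, hq₁⟩ := (Submodule.mem_span_range_iff_exists_fun _).1 hf
  have : NeZero s := ⟨by rintro rfl; simp at hq₁; exact hf0 hq₁.symm⟩
  obtain ⟨τ, hτ⟩ := σ.compat
  let ρ : ModuleOrdering ι s := σ.schreyer fun i => leadTerm σ (g i)
  have hρτ : ∀ a b, τ.le a b → ∀ T : ModTerm ι s, ρ.le (T.shift a) (T.shift b) := by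
    intro a b h T
    simp only [ρ, ModuleOrdering.schreyer, ModTerm.shift_fst, ModTerm.shift_snd,
      ← ModTerm.shift_shift]
    by_cases h' : (((leadTerm σ (g T.1)).shift T.2).shift a) =
        (((leadTerm σ (g T.1)).shift T.2).shift b)
    · exact Or.inr ⟨h', le_rfl⟩
    · exact Or.inl ⟨hτ a b h _, h'⟩
  -- Representations of `f` up to a multiplier with leading term `1`. Such multipliers are needed
  -- because subtracting `x^a q'` with `x^a < 1` changes the represented vector.
  let Q : Set (FreeVec K ι s) := {q | ∃ u : MvPolynomial ι K, MvPolynomial.coeff 0 u = 1 ∧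
    (∀ a ∈ u.support, τ.le a 0) ∧ ∑ i, q i • g i = u • f}
  have hτ0 : τ.le 0 0 := (τ.total 0 0).elim id id
  have hlead : ∀ u : MvPolynomial ι K, MvPolynomial.coeff 0 u = 1 →
      (∀ a ∈ u.support, τ.le a 0) → IsLeadTerm σ (u • f) (leadTerm σ f) :=
    fun u hu hu' => (leadTerm_spec σ hf0).unit_smul hτ hu hu'
  have hne : ∀ q ∈ Q, q ≠ 0 := by
    rintro _ ⟨u, hu, hu', hq⟩ rfl
    have h := hlead u hu hu'
    rw [← hq] at h
    exact ne_zero_of_mem_supp h.1 (by simp)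
  refine not_nonempty_of_descent (σ := ρ) hρτ hne ?_ ?_ ⟨q₁, 1, by simp, ?_, by simpa using hq₁⟩
  · rintro q ⟨u, hu, hu', hq⟩ q' ⟨w, hw, hw', hq'⟩ a ha ha0 c
    have hle : ∀ b, a ≤ b → MvPolynomial.coeff b (MvPolynomial.monomial a c * w) ≠ 0 →
        τ.le b a := by
      intro b hab hb
      obtain ⟨d, rfl⟩ := exists_add_of_le hab
      rw [MvPolynomial.coeff_monomial_mul] at hb
      have := τ.mul_le a _ _ (hw' d (MvPolynomial.mem_support_iff.2 (right_ne_zero_of_mul hb)))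
      rwa [add_zero] at this
    have hle' : ∀ b, MvPolynomial.coeff b (MvPolynomial.monomial a c * w) ≠ 0 → τ.le b a := by
      intro b hb
      refine hle b ?_ hb
      by_contra hab
      rw [MvPolynomial.coeff_monomial_mul', if_neg hab] at hb
      exact hb rfl
    -- All terms of `x^a w` are at most `x^a < 1`, so the constant coefficient stays `1`.
    refine ⟨u - MvPolynomial.monomial a c * w, ?_, ?_, ?_⟩
    · have h0 : MvPolynomial.coeff 0 (MvPolynomial.monomial a c * w) = 0 := by
        by_contra h
        exact ha0 (τ.antisymm _ _ ha (hle' 0 h))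
      rw [MvPolynomial.coeff_sub, h0, hu, sub_zero]
    · intro b hb
      rw [MvPolynomial.mem_support_iff, MvPolynomial.coeff_sub] at hb
      by_cases h : MvPolynomial.coeff b u = 0
      · refine τ.trans _ _ _ (hle' b fun h' => hb (by rw [h, h', sub_zero])) ha
      · exact hu' b (MvPolynomial.mem_support_iff.2 h)
    · simp only [Pi.sub_apply, Pi.smul_apply, sub_smul, Finset.sum_sub_distrib, hq, smul_assoc,
        ← Finset.smul_sum, hq', mul_smul]
  · rintro q ⟨u, hu, hu', hq⟩
    have hq0 : q ≠ 0 := hne q ⟨u, hu, hu', hq⟩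
    obtain ⟨A, hA⟩ : ∃ A, A = leadTerm ρ q := ⟨_, rfl⟩
    have hAm : A ∈ supp q := hA ▸ leadTerm_mem ρ hq0
    -- If the maximum were attained only at `A`, it would be the leading term of `u • f`, hence of
    -- `f`, and `LT(g_i)` would divide it.
    obtain ⟨B, hBm, hBA, hB⟩ : ∃ B ∈ supp q, B ≠ A ∧
        ¬ σ.lt ((leadTerm σ (g B.1)).shift B.2) ((leadTerm σ (g A.1)).shift A.2) := by
      by_contra! h
      have h1 := isLeadTerm_sum_smul hg hAm h
      rw [hq] at h1
      exact hnd A.1 ⟨A.2, (hlead u hu hu').eq h1⟩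
    obtain ⟨hBA', hBle⟩ := (hA ▸ le_leadTerm ρ hBm : ρ.le B A).resolve_left hB
    obtain ⟨i, a⟩ := A
    obtain ⟨j, b⟩ := B
    simp only at hB hBA' hBle
    have hcomp : (leadTerm σ (g i)).1 = (leadTerm σ (g j)).1 := (congrArg Prod.fst hBA').symm
    have hexp : b + (leadTerm σ (g j)).2 = a + (leadTerm σ (g i)).2 := congrArg Prod.snd hBA'
    have hij : i ≠ j := by
      rintro rfl
      exact hBA (Prod.ext rfl (add_right_cancel hexp))
    obtain ⟨z, hz0, hzA, hz⟩ := exists_syzygy hg hij (hS i j hcomp)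
    set T := lcmLead σ (g i) (g j) with hT
    -- The tie `x^a LT(g_i) = x^b LT(g_j)` is a common multiple, hence `x^d` times the lcm.
    obtain ⟨d, hd⟩ : ∃ d, a = d + (T.2 - (leadTerm σ (g i)).2) := by
      have h1 : T.2 ≤ a + (leadTerm σ (g i)).2 := sup_le le_add_self (hexp ▸ le_add_self)
      obtain ⟨d, hd⟩ := exists_add_of_le h1
      refine ⟨d, add_right_cancel (b := (leadTerm σ (g i)).2) ?_⟩
      rw [hd, add_assoc, tsub_add_cancel_of_le (show _ ≤ T.2 from le_sup_left), add_comm]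
    have hTA : T.shift d = (leadTerm σ (g i)).shift a := by
      refine Prod.ext rfl ?_
      rw [ModTerm.shift_snd, ModTerm.shift_snd, hd, add_assoc,
        tsub_add_cancel_of_le (show _ ≤ T.2 from le_sup_left)]
    set c : K := termCoeff q (i, a) / termCoeff z (i, T.2 - (leadTerm σ (g i)).2) with hc
    set q' := q - MvPolynomial.monomial d c • z with hq'
    have hq'Q : q' ∈ Q := by
      refine ⟨u, hu, hu', ?_⟩
      simp only [hq', Pi.sub_apply, Pi.smul_apply, sub_smul, Finset.sum_sub_distrib, hq,
        smul_assoc, ← Finset.smul_sum, hz0, smul_zero, sub_zero]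
    refine ⟨q', hq'Q, ?_⟩
    rw [← hA]
    have hm := leadTerm_mem ρ (hne q' hq'Q)
    have hcoeff : termCoeff q' (i, a) = 0 := by
      have h1 : ((i, a) : ModTerm ι s) =
          ModTerm.shift d (i, T.2 - (leadTerm σ (g i)).2) := Prod.ext rfl hd
      rw [hq', termCoeff_sub]
      nth_rewrite 2 [h1]
      rw [termCoeff_monomial_smul_shift, hc, div_mul_cancel₀ _ hzA, sub_self]
    refine ⟨?_, fun h => mem_supp_iff.1 hm (h ▸ hcoeff)⟩
    rcases mem_supp_or_of_mem_supp_sub hm with hm | hm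
    · rw [hA]; exact le_leadTerm ρ hm
    · obtain ⟨C, hC, hC'⟩ := exists_of_mem_supp_monomial_smul hm
      rw [hC']
      by_cases hCi : C = (i, T.2 - (leadTerm σ (g i)).2)
      · have : C.shift d = (i, a) := by rw [hCi]; exact Prod.ext rfl hd.symm
        rw [this]
        exact ρ.refl _
      -- The other terms of `x^d z` are smaller than `A`, or lie at `e_j` with the same value, where
      -- the tie-break decides: `j ≤ i` because `A` is the Schreyer-leading term.
      · rcases hz C hC hCi with h | h
        · left
          have := h.shift d
          rwa [hTA, ModTerm.shift_shift] at this
        · right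
          refine ⟨?_, h ▸ hBle⟩
          rw [← hTA, h]
          refine Prod.ext hcomp.symm ?_
          change (d + (T.2 - (leadTerm σ (g j)).2)) + (leadTerm σ (g j)).2 = d + T.2
          rw [add_assoc, tsub_add_cancel_of_le (show _ ≤ T.2 from le_sup_right)]
  · classical
    intro a ha
    rw [MvPolynomial.mem_support_iff, MvPolynomial.coeff_one] at ha
    split_ifs at ha with h
    · exact h ▸ hτ0
    · exact absurd rfl ha

end Criterion

/-! ## Homogenization and dehomogenization -/

section Dehomogenization

variable {K : Type*} [Field K] {m n r : ℕ}

theorem aeval_one_X_monomial (a : Fin m ⊕ Fin n →₀ ℕ) (c : K) :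
    MvPolynomial.aeval (R := K) (Sum.elim (fun _ : Fin m => (1 : MvPolynomial (Fin n) K))
      MvPolynomial.X) (MvPolynomial.monomial a c) = MvPolynomial.monomial (dehExp a) c := by
  rw [MvPolynomial.aeval_monomial, MvPolynomial.monomial_eq,
    Finsupp.prod_fintype _ _ (fun _ => pow_zero _), Finsupp.prod_fintype _ _ (fun _ => pow_zero _),
    Fintype.prod_sum_type]
  simp [dehExp, MvPolynomial.algebraMap_eq]

theorem dehVec_sub (U V : FreeVec K (Fin m ⊕ Fin n) r) :
    dehVec (U - V) = dehVec U - dehVec V := by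
  ext1 i; simp [dehVec]

@[simp] theorem dehVec_zero : dehVec (0 : FreeVec K (Fin m ⊕ Fin n) r) = 0 := by
  ext1 i; simp [dehVec]

theorem dehVec_monomial_smul (a : Fin m ⊕ Fin n →₀ ℕ) (c : K) (V : FreeVec K (Fin m ⊕ Fin n) r) :
    dehVec (MvPolynomial.monomial a c • V) = MvPolynomial.monomial (dehExp a) c • dehVec V := by
  ext1 i
  simp only [dehVec, Pi.smul_apply, smul_eq_mul, map_mul, aeval_one_X_monomial]

theorem termCoeff_dehVec [DecidableEq (ModTerm (Fin n) r)] (V : FreeVec K (Fin m ⊕ Fin n) r)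
    (S : ModTerm (Fin n) r) :
    termCoeff (dehVec V) S = ∑ T ∈ supp V, if dehTerm T = S then termCoeff V T else 0 := by
  classical
  have h : termCoeff (dehVec V) S = ∑ t ∈ (V S.1).support,
      if dehExp t = S.2 then MvPolynomial.coeff t (V S.1) else 0 := by
    rw [termCoeff, dehVec]
    nth_rewrite 1 [← MvPolynomial.support_sum_monomial_coeff (V S.1)]
    rw [map_sum, MvPolynomial.coeff_sum]
    simp only [aeval_one_X_monomial, MvPolynomial.coeff_monomial]
  rw [h, sum_supp, Finset.sum_eq_single S.1]
  · refine Finset.sum_congr rfl fun t _ => ?_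
    simp [dehTerm, Prod.ext_iff, termCoeff]
  · intro i _ hi
    refine Finset.sum_eq_zero fun t _ => if_neg fun h => hi (congrArg Prod.fst h)
  · simp

theorem exists_of_mem_supp_dehVec {V : FreeVec K (Fin m ⊕ Fin n) r} {S : ModTerm (Fin n) r}
    (h : S ∈ supp (dehVec V)) : ∃ T ∈ supp V, dehTerm T = S := by
  classical
  rw [mem_supp_iff, termCoeff_dehVec] at h
  obtain ⟨T, hT, h⟩ := Finset.exists_ne_zero_of_sum_ne_zero h
  exact ⟨T, hT, by_contra fun h' => h (if_neg h')⟩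

variable {W : Matrix (Fin m) (Fin n) ℤ} {δ : Fin r → Fin m → ℤ}

/-- Two terms of equal degree with equal image also have equal exponents in the `y_k`, so no
coefficients are added together. -/
theorem IsHomogeneousVec.termCoeff_dehVec {V : FreeVec K (Fin m ⊕ Fin n) r}
    (hV : IsHomogeneousVec W δ V) {T : ModTerm (Fin m ⊕ Fin n) r} (hT : T ∈ supp V) :
    termCoeff (dehVec V) (dehTerm T) = termCoeff V T := by
  classical
  obtain ⟨d, hd⟩ := hV
  rw [SelfSat.termCoeff_dehVec, Finset.sum_eq_single T, if_pos rfl]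
  · intro S hS hST
    exact if_neg fun h => hST (eq_of_deg_eq W δ ((hd S hS).trans (hd T hT).symm) h)
  · exact fun h => absurd hT h

theorem IsHomogeneousVec.dehTerm_mem_supp {V : FreeVec K (Fin m ⊕ Fin n) r}
    (hV : IsHomogeneousVec W δ V) {T : ModTerm (Fin m ⊕ Fin n) r} (hT : T ∈ supp V) :
    dehTerm T ∈ supp (dehVec V) := by
  rw [mem_supp_iff, hV.termCoeff_dehVec hT]
  exact mem_supp_iff.1 hT

theorem IsHomogeneousVec.dehVec_ne_zero {V : FreeVec K (Fin m ⊕ Fin n) r}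
    (hV : IsHomogeneousVec W δ V) (h0 : V ≠ 0) : dehVec V ≠ 0 := by
  obtain ⟨T, hT⟩ := supp_nonempty h0
  exact ne_zero_of_mem_supp (hV.dehTerm_mem_supp hT)

/-- Within one degree the extended ordering is `σ` on the dehomogenized terms. -/
theorem IsHomogeneousVec.leadTerm_dehVec [NeZero r] (σ : ModuleOrdering (Fin n) r)
    {V : FreeVec K (Fin m ⊕ Fin n) r} (hV : IsHomogeneousVec W δ V) (h0 : V ≠ 0) :
    leadTerm σ (dehVec V) = dehTerm (leadTerm (σ.extend W δ) V) := by
  have h := leadTerm_spec (σ.extend W δ) h0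
  refine leadTerm_eq ⟨hV.dehTerm_mem_supp h.1, fun S hS => ?_⟩
  obtain ⟨T, hT, rfl⟩ := exists_of_mem_supp_dehVec hS
  obtain ⟨d, hd⟩ := hV
  rcases h.2 T hT with h' | h'
  · rw [hd T hT, hd _ h.1] at h'
    exact absurd h' (lt_irrefl _)
  · exact h'.2

theorem IsHomogeneousVec.leadCoeff_dehVec [NeZero r] (σ : ModuleOrdering (Fin n) r)
    {V : FreeVec K (Fin m ⊕ Fin n) r} (hV : IsHomogeneousVec W δ V) (h0 : V ≠ 0) :
    leadCoeff σ (dehVec V) = leadCoeff (σ.extend W δ) V := by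
  rw [leadCoeff_eq, leadCoeff_eq, hV.leadTerm_dehVec σ h0,
    hV.termCoeff_dehVec (leadTerm_mem _ h0)]

theorem dehExp_sup_sub (a b c : Fin m ⊕ Fin n →₀ ℕ) :
    dehExp (a ⊔ b - c) = dehExp a ⊔ dehExp b - dehExp c := by
  ext j; simp [dehExp]

theorem dehVec_sVector [NeZero r] (σ : ModuleOrdering (Fin n) r)
    {U V : FreeVec K (Fin m ⊕ Fin n) r} (hU : IsHomogeneousVec W δ U) (hU0 : U ≠ 0)
    (hV : IsHomogeneousVec W δ V) (hV0 : V ≠ 0) :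
    dehVec (sVector (σ.extend W δ) U V) = sVector σ (dehVec U) (dehVec V) := by
  simp only [sVector, dehVec_sub, dehVec_monomial_smul, hU.leadTerm_dehVec σ hU0,
    hV.leadTerm_dehVec σ hV0, hU.leadCoeff_dehVec σ hU0, hV.leadCoeff_dehVec σ hV0,
    dehExp_sup_sub, dehTerm]

theorem IsHomogeneousVec.deg_monomial_smul {V : FreeVec K (Fin m ⊕ Fin n) r}
    (hV : IsHomogeneousVec W δ V) {a : Fin m ⊕ Fin n →₀ ℕ} {c : K}
    {S : ModTerm (Fin m ⊕ Fin n) r} (hS : S ∈ supp V) {T : ModTerm (Fin m ⊕ Fin n) r}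
    (hT : T ∈ supp (MvPolynomial.monomial a c • V)) :
    deg (extMatrix W) δ T = deg (extMatrix W) δ (S.shift a) := by
  obtain ⟨d, hd⟩ := hV
  obtain ⟨T, hT', rfl⟩ := exists_of_mem_supp_monomial_smul hT
  rw [deg_shift, deg_shift, hd T hT', hd S hS]

theorem isHomogeneousVec_sVector [NeZero r] (σ : ModuleOrdering (Fin m ⊕ Fin n) r)
    {U V : FreeVec K (Fin m ⊕ Fin n) r} (hU : IsHomogeneousVec W δ U) (hU0 : U ≠ 0)
    (hV : IsHomogeneousVec W δ V) (hV0 : V ≠ 0)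
    (hcomp : (leadTerm σ U).1 = (leadTerm σ V).1) : IsHomogeneousVec W δ (sVector σ U V) := by
  refine ⟨deg (extMatrix W) δ (lcmLead σ U V), fun T hT => ?_⟩
  rcases mem_supp_or_of_mem_supp_sub hT with hT | hT
  · rw [hU.deg_monomial_smul (leadTerm_mem σ hU0) hT]
    congr 1
    exact Prod.ext rfl (tsub_add_cancel_of_le le_sup_left)
  · rw [hV.deg_monomial_smul (leadTerm_mem σ hV0) hT]
    congr 1
    exact Prod.ext hcomp.symm (tsub_add_cancel_of_le le_sup_right)

theorem DivisionStep.isHomogeneousVec [NeZero r] {σ : ModuleOrdering (Fin m ⊕ Fin n) r}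
    {G : Multiset (FreeVec K (Fin m ⊕ Fin n) r)} {R R' : FreeVec K (Fin m ⊕ Fin n) r}
    (h : DivisionStep σ G R R') (hR : IsHomogeneousVec W δ R)
    (hG : ∀ U ∈ G, IsHomogeneousVec W δ U ∧ U ≠ 0) : IsHomogeneousVec W δ R' := by
  obtain ⟨U, hU, a, ha, rfl⟩ := h
  obtain ⟨d, hd⟩ := hR
  refine ⟨d, fun T hT => ?_⟩
  rcases mem_supp_or_of_mem_supp_sub hT with hT | hT
  · exact hd T hT
  · rw [(hG U hU).1.deg_monomial_smul (leadTerm_mem σ (hG U hU).2) hT]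
    exact hd _ ha

/-- A division step of homogeneous vectors dehomogenizes to a division step. -/
theorem DivisionStep.dehVec [NeZero r] {σ : ModuleOrdering (Fin n) r}
    {G : Multiset (FreeVec K (Fin m ⊕ Fin n) r)} {R R' : FreeVec K (Fin m ⊕ Fin n) r}
    (h : DivisionStep (σ.extend W δ) G R R') (hR : IsHomogeneousVec W δ R)
    (hG : ∀ U ∈ G, IsHomogeneousVec W δ U ∧ U ≠ 0) :
    DivisionStep σ (G.map dehVec) (dehVec R) (dehVec R') := by
  obtain ⟨U, hU, a, ha, rfl⟩ := h
  have hU' := hG U hU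
  have h1 : dehTerm ((leadTerm (σ.extend W δ) U).shift a) =
      (leadTerm σ (SelfSat.dehVec U)).shift (dehExp a) := by
    rw [hU'.1.leadTerm_dehVec σ hU'.2, dehTerm_shift]
  refine ⟨SelfSat.dehVec U, Multiset.mem_map_of_mem _ hU, dehExp a, ?_, ?_⟩
  · rw [← h1]
    exact hR.dehTerm_mem_supp ha
  · have h2 := hR.termCoeff_dehVec ha
    rw [h1] at h2
    simp only [termCoeff, ModTerm.shift_fst, ModTerm.shift_snd] at h2
    rw [dehVec_sub, dehVec_monomial_smul, hU'.1.leadCoeff_dehVec σ hU'.2, h2]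

theorem dehExp_sumElim (e : Fin m →₀ ℕ) (t : Fin n →₀ ℕ) : dehExp (Finsupp.sumElim e t) = t := by
  ext j; simp [dehExp]

@[simp] theorem dehVec_homVec (v : FreeVec K (Fin n) r) : dehVec (homVec W δ v) = v := by
  ext1 i
  simp only [dehVec, homVec, map_sum, aeval_one_X_monomial, dehExp_sumElim]
  exact MvPolynomial.support_sum_monomial_coeff (v i)

theorem isHomogeneousVec_homVec (v : FreeVec K (Fin n) r) :
    IsHomogeneousVec W δ (homVec W δ v) := by
  classical
  refine ⟨topDeg W δ v, fun T hT => ?_⟩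
  obtain ⟨i, a⟩ := T
  rw [mem_supp_iff, termCoeff, homVec, MvPolynomial.coeff_sum] at hT
  obtain ⟨t, ht, h⟩ := Finset.exists_ne_zero_of_sum_ne_zero hT
  rw [MvPolynomial.coeff_monomial] at h
  have ha := by_contra fun h' => h (if_neg h')
  dsimp only at ha
  subst ha
  ext k
  rw [deg_extMatrix, dehTerm]
  simp only [dehExp_sumElim]
  have hmem : (i, t) ∈ supp v := (mem_supp v _).2 (MvPolynomial.mem_support_iff.1 ht)
  have hle : deg W δ (i, t) k ≤ topDeg W δ v k := by
    rw [topDeg, dif_pos ⟨_, hmem⟩]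
    exact Finset.le_sup' (fun T => deg W δ T k) hmem
  simp [hle]

/-- Dehomogenization undoes homogenization, so the saturation determines the dehomogenized vector.
Saturating replacements are therefore invisible in `F`. -/
theorem SatSubst.dehVec_eq {R R' : FreeVec K (Fin m ⊕ Fin n) r} (h : SatSubst W δ R R') :
    dehVec R' = dehVec R := by
  have := congrArg dehVec h.2
  simpa only [satVec, dehVec_homVec] using this

end Dehomogenization

/-! ## The invariant of the runs -/

section Treated

variable {K : Type*} [Field K] {ι : Type} {r : ℕ} [NeZero r] {σ : ModuleOrdering ι r}

/-- The S-vector of `u` and `v` has been reduced to `w` by means of `G`. -/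
def Treated (σ : ModuleOrdering ι r) (G : Set (FreeVec K ι r)) (w u v : FreeVec K ι r) : Prop :=
  sVector σ u v - w ∈ standardSpan σ G (lcmLead σ u v) ∧
    ∀ T ∈ supp w, σ.lt T (lcmLead σ u v)

theorem sVector_swap (u v : FreeVec K ι r) : sVector σ v u = -sVector σ u v := by
  rw [sVector, sVector, neg_sub, sup_comm]

theorem lcmLead_comm {u v : FreeVec K ι r} (h : (leadTerm σ u).1 = (leadTerm σ v).1) :
    lcmLead σ v u = lcmLead σ u v := by
  rw [lcmLead, lcmLead, h, sup_comm]

/-- Both multiples have the lcm as leading term, with coefficient `1`, and these cancel. -/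
theorem lt_lcmLead_of_mem_supp_sVector {u v : FreeVec K ι r} (hu : u ≠ 0) (hv : v ≠ 0)
    (h : (leadTerm σ u).1 = (leadTerm σ v).1) {T : ModTerm ι r} (hT : T ∈ supp (sVector σ u v)) :
    σ.lt T (lcmLead σ u v) := by
  have h1 : (leadTerm σ u).shift ((lcmLead σ u v).2 - (leadTerm σ u).2) = lcmLead σ u v :=
    Prod.ext rfl (tsub_add_cancel_of_le le_sup_left)
  have h2 : (leadTerm σ v).shift ((lcmLead σ u v).2 - (leadTerm σ v).2) = lcmLead σ u v :=
    Prod.ext h.symm (tsub_add_cancel_of_le le_sup_right)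
  constructor
  · rcases mem_supp_or_of_mem_supp_sub hT with hT | hT
    · obtain ⟨S, hS, rfl⟩ := exists_of_mem_supp_monomial_smul hT
      rw [← h1]
      exact σ.mul_le _ _ _ (le_leadTerm σ hS)
    · obtain ⟨S, hS, rfl⟩ := exists_of_mem_supp_monomial_smul hT
      rw [← h2]
      exact σ.mul_le _ _ _ (le_leadTerm σ hS)
  · rintro rfl
    rw [mem_supp_iff] at hT
    refine hT ?_
    have e1 := termCoeff_monomial_smul_shift ((lcmLead σ u v).2 - (leadTerm σ u).2)
      (leadCoeff σ u)⁻¹ u (leadTerm σ u)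
    have e2 := termCoeff_monomial_smul_shift ((lcmLead σ u v).2 - (leadTerm σ v).2)
      (leadCoeff σ v)⁻¹ v (leadTerm σ v)
    rw [h1, ← leadCoeff_eq, inv_mul_cancel₀ (leadCoeff_ne_zero σ hu)] at e1
    rw [h2, ← leadCoeff_eq, inv_mul_cancel₀ (leadCoeff_ne_zero σ hv)] at e2
    rw [sVector, termCoeff_sub]
    exact sub_eq_zero.2 (e1.trans e2.symm)

theorem Treated.sVector (G : Set (FreeVec K ι r)) {u v : FreeVec K ι r} (hu : u ≠ 0) (hv : v ≠ 0)
    (h : (leadTerm σ u).1 = (leadTerm σ v).1) : Treated σ G (sVector σ u v) u v :=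
  ⟨by rw [sub_self]; exact zero_mem _, fun _ => lt_lcmLead_of_mem_supp_sVector hu hv h⟩

theorem Treated.mono {G H : Set (FreeVec K ι r)} {w u v : FreeVec K ι r} (h : Treated σ G w u v)
    (hGH : G ⊆ H) : Treated σ H w u v :=
  ⟨standardSpan_mono hGH _ h.1, h.2⟩

/-- As the leading term of `w` is below the lcm, `w = 1 • w` is an admissible summand once it
belongs to `G`; no irreducibility of `w` is required. -/
theorem Treated.zero_of_mem {G : Set (FreeVec K ι r)} {w u v : FreeVec K ι r}
    (h : Treated σ G w u v) (hw : w ∈ G) (hw0 : w ≠ 0) : Treated σ G 0 u v := by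
  refine ⟨?_, by simp⟩
  have h1 : MvPolynomial.monomial 0 (1 : K) • w ∈ standardSpan σ G (lcmLead σ u v) :=
    monomial_smul_mem_standardSpan hw 1 (by
      rw [ModTerm.shift_zero]; exact h.2 _ (leadTerm_mem σ hw0))
  have h2 := add_mem h.1 h1
  rwa [show MvPolynomial.monomial 0 (1 : K) = 1 from rfl, one_smul, sub_add_cancel,
    ← sub_zero (SelfSat.sVector σ u v)] at h2

/-- The subtracted multiple has a leading term that occurs in `w`, hence lies below the lcm. -/
theorem Treated.divisionStep {G : Multiset (FreeVec K ι r)} {w w' u v : FreeVec K ι r}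
    (h : Treated σ {g | g ∈ G} w u v) (hs : DivisionStep σ G w w') :
    Treated σ {g | g ∈ G} w' u v := by
  obtain ⟨g, hg, a, ha, rfl⟩ := hs
  have hlt := h.2 _ ha
  constructor
  · rw [← sub_add]
    exact add_mem h.1 (monomial_smul_mem_standardSpan hg _ hlt)
  · intro T hT
    rcases mem_supp_or_of_mem_supp_sub hT with hT | hT
    · exact h.2 T hT
    · obtain ⟨S, hS, rfl⟩ := exists_of_mem_supp_monomial_smul hT
      exact ModuleOrdering.lt_of_le_of_lt (σ.mul_le _ _ _ (le_leadTerm σ hS)) hlt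

end Treated

/-! ### Preservation along runs, and the Gröbner basis property of the output -/

section Invariant

variable {K : Type*} [Field K] {m n r : ℕ} [NeZero r]

/-- What all states of a run on generators of `M` have in common. -/
structure Invariant (W : Matrix (Fin m) (Fin n) ℤ) (δ : Fin r → Fin m → ℤ)
    (σ : ModuleOrdering (Fin n) r) (M : Submodule (MvPolynomial (Fin n) K) (FreeVec K (Fin n) r))
    (S : State K m n r) : Prop where
  gens_hom : ∀ U ∈ S.gens, IsHomogeneousVec W δ U
  basis_hom : ∀ U ∈ S.basis, IsHomogeneousVec W δ U ∧ U ≠ 0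
  current_hom : ∀ R ∈ S.current, IsHomogeneousVec W δ R
  pairs_mem : ∀ p ∈ S.pairs, p.1 ∈ S.basis ∧ p.2 ∈ S.basis ∧
    (leadTerm (σ.extend W δ) p.1).1 = (leadTerm (σ.extend W δ) p.2).1
  gens_mem : ∀ U ∈ S.gens, dehVec U ∈ M
  basis_mem : ∀ U ∈ S.basis, dehVec U ∈ M
  current_mem : ∀ R ∈ S.current, dehVec R ∈ M
  -- Generation of `M`, phrased through all submodules `N`. Pairs may be left out, since their
  -- S-vectors lie in the span of the basis.
  le_of_mem : ∀ N : Submodule (MvPolynomial (Fin n) K) (FreeVec K (Fin n) r),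
    (∀ U ∈ S.gens, dehVec U ∈ N) → (∀ U ∈ S.basis, dehVec U ∈ N) →
      (∀ R ∈ S.current, dehVec R ∈ N) → M ≤ N
  -- Only one orientation of a pair is ever recorded, so either one suffices; the S-vector is
  -- antisymmetric.
  treated : ∀ U ∈ S.basis, ∀ V ∈ S.basis,
    (leadTerm (σ.extend W δ) U).1 = (leadTerm (σ.extend W δ) V).1 →
      ((U, V) ∈ S.pairs ∨
        Treated σ {g | g ∈ S.basis.map dehVec} 0 (dehVec U) (dehVec V) ∨
        ∃ R ∈ S.current, Treated σ {g | g ∈ S.basis.map dehVec} (dehVec R) (dehVec U) (dehVec V)) ∨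
      ((V, U) ∈ S.pairs ∨
        Treated σ {g | g ∈ S.basis.map dehVec} 0 (dehVec V) (dehVec U) ∨
        ∃ R ∈ S.current, Treated σ {g | g ∈ S.basis.map dehVec} (dehVec R) (dehVec V) (dehVec U))

variable {W : Matrix (Fin m) (Fin n) ℤ} {δ : Fin r → Fin m → ℤ} {σ : ModuleOrdering (Fin n) r}
  {M : Submodule (MvPolynomial (Fin n) K) (FreeVec K (Fin n) r)}

theorem DivisionStep.exists_eq_sub {ι : Type} {σ : ModuleOrdering ι r}
    {G : Multiset (FreeVec K ι r)} {R R' : FreeVec K ι r} (h : DivisionStep σ G R R') :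
    ∃ g ∈ G, ∃ p : MvPolynomial ι K, R' = R - p • g := by
  obtain ⟨g, hg, a, -, h⟩ := h
  exact ⟨g, hg, _, h⟩

/-- Each S-vector passes from a waiting pair to the current remainder, is reduced there, and ends
with a standard representation, because its remainder is zero or joins the basis. -/
theorem Invariant.step {S S' : State K m n r} (h : Invariant W δ σ M S) (hs : Step W δ σ S S') :
    Invariant W δ σ M S' := by
  classical
  cases hs with
  | chooseGen U gens pairs G =>
    obtain ⟨h1, h2, h3, h4, h5, h6, h7, h8, h9⟩ := h
    simp only [Multiset.mem_cons, forall_eq_or_imp, Option.mem_def, reduceCtorEq, false_and,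
      exists_false, or_false, IsEmpty.forall_iff, implies_true, forall_const] at *
    refine ⟨h1.2, h2, ?_, h4, h5.2, h6, ?_, ?_, ?_⟩
    · rintro _ ⟨⟩; exact h1.1
    · rintro _ ⟨⟩; exact h5.1
    · exact fun N hN hN' hR => h8 N ⟨hR U rfl, hN⟩ hN'
    · exact fun U hU V hV hUV => (h9 U hU V hV hUV).imp (Or.imp_right Or.inl) (Or.imp_right Or.inl)
  | choosePair U V gens pairs G =>
    obtain ⟨h1, h2, h3, h4, h5, h6, h7, h8, h9⟩ := h
    obtain ⟨hU, hV, hUV⟩ := h4 (U, V) (Multiset.mem_cons_self _ _)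
    dsimp only at *
    obtain ⟨hUh, hU0⟩ := h2 U hU
    obtain ⟨hVh, hV0⟩ := h2 V hV
    have hdeh := dehVec_sVector σ hUh hU0 hVh hV0
    have hcomp : (leadTerm σ (dehVec U)).1 = (leadTerm σ (dehVec V)).1 := by
      rw [hUh.leadTerm_dehVec σ hU0, hVh.leadTerm_dehVec σ hV0]
      exact hUV
    have hT := Treated.sVector {g | g ∈ G.map dehVec} (hUh.dehVec_ne_zero hU0)
      (hVh.dehVec_ne_zero hV0) hcomp
    rw [← hdeh] at hT
    refine ⟨h1, h2, ?_, fun p hp => h4 p (Multiset.mem_cons_of_mem hp), h5, h6, ?_, ?_, ?_⟩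
    · rintro _ ⟨⟩; exact isHomogeneousVec_sVector _ hUh hU0 hVh hV0 hUV
    · rintro _ ⟨⟩
      rw [hdeh]
      exact sub_mem (M.smul_mem _ (h6 U hU)) (M.smul_mem _ (h6 V hV))
    · exact fun N hN hN' _ => h8 N hN hN' (by simp)
    · have key : ∀ U' V', ((U', V') ∈ (U, V) ::ₘ pairs ∨
          Treated σ {g | g ∈ G.map dehVec} 0 (dehVec U') (dehVec V') ∨
          ∃ R ∈ (none : Option (FreeVec K (Fin m ⊕ Fin n) r)),
            Treated σ {g | g ∈ G.map dehVec} (dehVec R) (dehVec U') (dehVec V')) →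
          ((U', V') ∈ pairs ∨
          Treated σ {g | g ∈ G.map dehVec} 0 (dehVec U') (dehVec V') ∨
          ∃ R ∈ some (sVector (σ.extend W δ) U V),
            Treated σ {g | g ∈ G.map dehVec} (dehVec R) (dehVec U') (dehVec V')) := by
        rintro U' V' (h | h | ⟨_, ⟨⟩, _⟩)
        · rcases Multiset.mem_cons.1 h with h | h
          · obtain ⟨rfl, rfl⟩ := Prod.mk.inj h
            exact Or.inr (Or.inr ⟨_, rfl, hT⟩)
          · exact Or.inl h
        · exact Or.inr (Or.inl h)
      exact fun U' hU' V' hV' h => (h9 U' hU' V' hV' h).imp (key U' V') (key V' U')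
  | reduce gens pairs G R R' R'' hsat hdiv =>
    obtain ⟨h1, h2, h3, h4, h5, h6, h7, h8, h9⟩ := h
    dsimp only at *
    -- The division is performed on `R'`, but `R'` and `R` have the same image, so downstairs
    -- `dehVec R` itself is divided.
    have hdiv' := hdiv.dehVec hsat.1 h2
    rw [hsat.dehVec_eq] at hdiv'
    obtain ⟨g, hg, p, hp⟩ := hdiv'.exists_eq_sub
    obtain ⟨U, hU, rfl⟩ := Multiset.mem_map.1 hg
    refine ⟨h1, h2, ?_, h4, h5, h6, ?_, ?_, ?_⟩
    · rintro _ ⟨⟩; exact hdiv.isHomogeneousVec hsat.1 h2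
    · rintro _ ⟨⟩
      rw [hp]
      exact sub_mem (h7 R rfl) (M.smul_mem _ (h6 U hU))
    · intro N hN hN' hR
      refine h8 N hN hN' ?_
      rintro _ ⟨⟩
      have := add_mem (hR R'' rfl) (N.smul_mem p (hN' U hU))
      rwa [hp, sub_add_cancel] at this
    · have key : ∀ u v, (∃ Q ∈ some R, Treated σ {g | g ∈ G.map dehVec} (dehVec Q) u v) →
          ∃ Q ∈ some R'', Treated σ {g | g ∈ G.map dehVec} (dehVec Q) u v := by
        rintro u v ⟨_, ⟨⟩, h⟩
        exact ⟨R'', rfl, h.divisionStep hdiv'⟩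
      exact fun U' hU' V' hV' h => (h9 U' hU' V' hV' h).imp
        (Or.imp_right (Or.imp_right (key _ _))) (Or.imp_right (Or.imp_right (key _ _)))
  | finishZero gens pairs G R hsat =>
    obtain ⟨h1, h2, h3, h4, h5, h6, h7, h8, h9⟩ := h
    dsimp only at *
    have hR : dehVec R = 0 := by rw [← hsat.dehVec_eq, dehVec_zero]
    refine ⟨h1, h2, by simp, h4, h5, h6, by simp, ?_, ?_⟩
    · intro N hN hN' _
      refine h8 N hN hN' ?_
      rintro _ ⟨⟩
      rw [hR]
      exact zero_mem N
    · have key : ∀ u v, (Treated σ {g | g ∈ G.map dehVec} 0 u v ∨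
          ∃ Q ∈ some R, Treated σ {g | g ∈ G.map dehVec} (dehVec Q) u v) →
          Treated σ {g | g ∈ G.map dehVec} 0 u v ∨
          ∃ Q ∈ (none : Option (FreeVec K (Fin m ⊕ Fin n) r)),
            Treated σ {g | g ∈ G.map dehVec} (dehVec Q) u v := by
        rintro u v (h | ⟨_, ⟨⟩, h⟩)
        · exact Or.inl h
        · exact Or.inl (hR ▸ h)
      exact fun U' hU' V' hV' h => (h9 U' hU' V' hV' h).imp
        (Or.imp_right (key _ _)) (Or.imp_right (key _ _))
  | finishNonzero gens pairs G R V hsat hV hirr =>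
    obtain ⟨h1, h2, h3, h4, h5, h6, h7, h8, h9⟩ := h
    dsimp only at *
    have hVR : dehVec V = dehVec R := hsat.dehVec_eq
    have hnew : ∀ p, p ∈ newPairs (σ.extend W δ) V G ↔ ∃ U ∈ G,
        (leadTerm (σ.extend W δ) U).1 = (leadTerm (σ.extend W δ) V).1 ∧ (V, U) = p := by
      intro p
      simp only [newPairs, Multiset.mem_map, Multiset.mem_filter, and_assoc]
    have hsub : {g | g ∈ G.map dehVec} ⊆ {g | g ∈ (V ::ₘ G).map dehVec} := by
      intro g hg
      rw [Set.mem_ofPred_eq, Multiset.map_cons]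
      exact Multiset.mem_cons_of_mem hg
    have hV0 : dehVec V ≠ 0 := hsat.1.dehVec_ne_zero hV
    refine ⟨h1, ?_, by simp, ?_, h5, ?_, by simp, ?_, ?_⟩
    · intro U hU
      rcases Multiset.mem_cons.1 hU with rfl | hU
      · exact ⟨hsat.1, hV⟩
      · exact h2 U hU
    · intro p hp
      rcases Multiset.mem_add.1 hp with hp | hp
      · obtain ⟨ha, hb, hc⟩ := h4 p hp
        exact ⟨Multiset.mem_cons_of_mem ha, Multiset.mem_cons_of_mem hb, hc⟩
      · obtain ⟨U, hU, hUV, rfl⟩ := (hnew p).1 hp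
        exact ⟨Multiset.mem_cons_self _ _, Multiset.mem_cons_of_mem hU, hUV.symm⟩
    · intro U hU
      rcases Multiset.mem_cons.1 hU with rfl | hU
      · rw [hVR]; exact h7 R rfl
      · exact h6 U hU
    · intro N hN hN' _
      refine h8 N hN (fun U hU => hN' U (Multiset.mem_cons_of_mem hU)) ?_
      rintro _ ⟨⟩
      rw [← hVR]
      exact hN' V (Multiset.mem_cons_self _ _)
    · have key : ∀ U' V', ((U', V') ∈ pairs ∨
          Treated σ {g | g ∈ G.map dehVec} 0 (dehVec U') (dehVec V') ∨
          ∃ Q ∈ some R, Treated σ {g | g ∈ G.map dehVec} (dehVec Q) (dehVec U') (dehVec V')) →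
          ((U', V') ∈ pairs + newPairs (σ.extend W δ) V G ∨
          Treated σ {g | g ∈ (V ::ₘ G).map dehVec} 0 (dehVec U') (dehVec V') ∨
          ∃ Q ∈ (none : Option (FreeVec K (Fin m ⊕ Fin n) r)),
            Treated σ {g | g ∈ (V ::ₘ G).map dehVec} (dehVec Q) (dehVec U') (dehVec V')) := by
        rintro U' V' (h | h | ⟨_, ⟨⟩, h⟩)
        · exact Or.inl (Multiset.mem_add.2 (Or.inl h))
        · exact Or.inr (Or.inl (h.mono hsub))
        · refine Or.inr (Or.inl ?_)
          rw [← hVR] at h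
          exact (h.mono hsub).zero_of_mem (by simp) hV0
      intro U' hU' V' hV' h
      rcases Multiset.mem_cons.1 hU' with hUV | hU' <;>
        rcases Multiset.mem_cons.1 hV' with hVV | hV'
      -- The pair of `V` with itself never enters the list; its S-vector is zero.
      · refine Or.inl (Or.inr (Or.inl ?_))
        have := Treated.sVector {g | g ∈ (V ::ₘ G).map dehVec} hV0 hV0 (σ := σ) rfl
        rw [show sVector σ (dehVec V) (dehVec V) = 0 from sub_self _] at this
        rwa [hUV, hVV]
      · rw [hUV] at h ⊢
        exact Or.inl (Or.inl (Multiset.mem_add.2 (Or.inr ((hnew _).2 ⟨V', hV', h.symm, rfl⟩))))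
      · rw [hVV] at h ⊢
        exact Or.inr (Or.inl (Multiset.mem_add.2 (Or.inr ((hnew _).2 ⟨U', hU', h, rfl⟩))))
      · exact (h9 U' hU' V' hV' h).imp (key U' V') (key V' U')

theorem invariant_initState {s : ℕ} (v : Fin s → FreeVec K (Fin n) r) :
    Invariant W δ σ (Submodule.span (MvPolynomial (Fin n) K) (Set.range v))
      (initState fun i => homVec W δ (v i)) := by
  have hmem : ∀ U, U ∈ (initState fun i => homVec W δ (v i)).gens ↔ ∃ i, homVec W δ (v i) = U := by
    intro U
    simp [initState, List.mem_ofFn]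
  refine ⟨?_, by simp [initState], by simp [initState], by simp [initState], ?_,
    by simp [initState], by simp [initState], ?_, by simp [initState]⟩
  · intro U hU
    obtain ⟨i, rfl⟩ := (hmem U).1 hU
    exact isHomogeneousVec_homVec _
  · intro U hU
    obtain ⟨i, rfl⟩ := (hmem U).1 hU
    rw [dehVec_homVec]
    exact Submodule.subset_span ⟨i, rfl⟩
  · intro N hN _ _
    rw [Submodule.span_le]
    rintro _ ⟨i, rfl⟩
    have := hN _ ((hmem _).2 ⟨i, rfl⟩)
    rwa [dehVec_homVec] at this

theorem Reachable.invariant {s : ℕ} {v : Fin s → FreeVec K (Fin n) r} {S : State K m n r}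
    (h : Reachable W δ σ (fun i => homVec W δ (v i)) S) :
    Invariant W δ σ (Submodule.span (MvPolynomial (Fin n) K) (Set.range v)) S := by
  induction h with
  | refl => exact invariant_initState v
  | tail _ hs ih => exact ih.step hs

theorem Invariant.isGroebnerBasis {G : Multiset (FreeVec K (Fin m ⊕ Fin n) r)}
    (h : Invariant W δ σ M (finalState G)) :
    IsGroebnerBasis σ M (dehVec '' {V | V ∈ G}) := by
  obtain ⟨h1, h2, h3, h4, h5, h6, h7, h8, h9⟩ := h
  simp only [finalState] at *
  have hspan : Submodule.span (MvPolynomial (Fin n) K) (dehVec '' {V | V ∈ G}) = M := by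
    refine le_antisymm (Submodule.span_le.2 ?_) (h8 _ (by simp) ?_ (by simp))
    · rintro _ ⟨U, hU, rfl⟩
      exact h6 U hU
    · exact fun U hU => Submodule.subset_span ⟨U, hU, rfl⟩
  refine ⟨?_, hspan, ?_⟩
  · rintro _ ⟨U, hU, rfl⟩
    exact (h2 U hU).1.dehVec_ne_zero (h2 U hU).2
  · intro u hu hu0
    -- Different basis elements may have the same image, so the list can contain repetitions; the
    -- criterion is stated for families and permits them.
    let g : Fin (G.map dehVec).toList.length → FreeVec K (Fin n) r := (G.map dehVec).toList.get
    have hrange : Set.range g = {x | x ∈ G.map dehVec} := by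
      rw [Set.range_list_get]
      ext x
      rw [Set.mem_ofPred_eq, Multiset.mem_toList, Set.mem_ofPred_eq]
    have hrange' : Set.range g = dehVec '' {V | V ∈ G} := by
      rw [hrange]
      ext x
      simp
    have hg : ∀ i, ∃ U ∈ G, dehVec U = g i := fun i => by
      have : g i ∈ dehVec '' {V | V ∈ G} := hrange' ▸ ⟨i, rfl⟩
      exact this
    have hS : ∀ i j, (leadTerm σ (g i)).1 = (leadTerm σ (g j)).1 →
        sVector σ (g i) (g j) ∈ standardSpan σ (Set.range g) (lcmLead σ (g i) (g j)) := by
      intro i j hij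
      obtain ⟨U, hU, hUi⟩ := hg i
      obtain ⟨V, hV, hVj⟩ := hg j
      have hUV : (leadTerm (σ.extend W δ) U).1 = (leadTerm (σ.extend W δ) V).1 := by
        rw [← hUi, ← hVj, (h2 U hU).1.leadTerm_dehVec σ (h2 U hU).2,
          (h2 V hV).1.leadTerm_dehVec σ (h2 V hV).2] at hij
        exact hij
      have := h9 U hU V hV hUV
      simp only [Multiset.notMem_zero, Option.mem_def, reduceCtorEq, false_and, exists_false,
        false_or, or_false, Treated, sub_zero, hUi, hVj] at this
      rw [hrange]
      rcases this with h | h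
      · exact h.1
      · rw [sVector_swap, lcmLead_comm hij.symm]
        exact neg_mem h.1
    have hu' : u ∈ Submodule.span (MvPolynomial (Fin n) K) (Set.range g) := by
      rwa [hrange', hspan]
    have hg0 : ∀ i, g i ≠ 0 := fun i => by
      obtain ⟨U, hU, hUi⟩ := hg i
      rw [← hUi]
      exact (h2 U hU).1.dehVec_ne_zero (h2 U hU).2
    obtain ⟨i, hi⟩ := exists_leadTerm_dvd_of_sVector_mem hg0 hS hu' hu0
    exact ⟨g i, hrange' ▸ ⟨i, rfl⟩, hi⟩

end Invariant

/-! ## Termination -/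

section Termination

variable {K : Type*} [Field K] {ι : Type} {m n r : ℕ}

/-- The characteristic function of the support of a vector. -/
noncomputable def suppIndicator (v : FreeVec K ι r) : ModTerm ι r →₀ ℕ :=
  Finsupp.indicator (supp v) fun _ _ => 1

theorem suppIndicator_of_mem {v : FreeVec K ι r} {T : ModTerm ι r} (h : T ∈ supp v) :
    suppIndicator v T = 1 :=
  Finsupp.indicator_of_mem h _

theorem suppIndicator_of_notMem {v : FreeVec K ι r} {T : ModTerm ι r} (h : T ∉ supp v) :
    suppIndicator v T = 0 :=
  Finsupp.indicator_of_notMem h _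

/-- Finite sets of terms are compared at the largest term where they differ, hence the reversed
relation on positions. -/
theorem ModuleOrdering.IsTermOrdering.wellFounded_lex [Finite ι] {σ : ModuleOrdering ι r}
    (hσ : σ.IsTermOrdering) :
    WellFounded (Finsupp.Lex (N := ℕ) (fun S T => σ.lt T S) (· < ·)) := by
  have : Std.Trichotomous (fun S T => σ.lt T S) := by
    refine ⟨fun S T h h' => ?_⟩
    exact σ.antisymm _ _ ((σ.lt_or_le T S).resolve_left h) ((σ.lt_or_le S T).resolve_left h')
  exact Finsupp.Lex.wellFounded' (fun _ => Nat.not_lt_zero _) _root_.wellFounded_lt hσ.wellFounded_lt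

variable [NeZero r]

/-- A division step removes a term from the support and changes nothing above that term. -/
theorem DivisionStep.suppIndicator_lex {σ : ModuleOrdering ι r} {G : Multiset (FreeVec K ι r)}
    {R R' : FreeVec K ι r} (h : DivisionStep σ G R R') (hG : ∀ g ∈ G, g ≠ 0) :
    Finsupp.Lex (fun S T => σ.lt T S) (· < ·) (suppIndicator R') (suppIndicator R) := by
  obtain ⟨g, hg, a, ha, rfl⟩ := h
  set T := (leadTerm σ g).shift a with hT
  set c : K := MvPolynomial.coeff (a + (leadTerm σ g).2) (R (leadTerm σ g).1) / leadCoeff σ g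
    with hc
  refine ⟨T, fun S hS => ?_, ?_⟩
  · have h0 : termCoeff (MvPolynomial.monomial a c • g) S = 0 := by
      rw [← notMem_supp_iff]
      intro h
      obtain ⟨U, hU, rfl⟩ := exists_of_mem_supp_monomial_smul h
      exact ModuleOrdering.lt_irrefl _
        (ModuleOrdering.lt_of_lt_of_le hS (σ.mul_le _ _ _ (le_leadTerm σ hU)))
    have h1 : S ∈ supp (R - MvPolynomial.monomial a c • g) ↔ S ∈ supp R := by
      rw [mem_supp_iff, mem_supp_iff, termCoeff_sub, h0, sub_zero]
    by_cases h : S ∈ supp R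
    · rw [suppIndicator_of_mem h, suppIndicator_of_mem (h1.2 h)]
    · rw [suppIndicator_of_notMem h, suppIndicator_of_notMem (mt h1.1 h)]
  · have h1 : T ∉ supp (R - MvPolynomial.monomial a c • g) := by
      rw [notMem_supp_iff, termCoeff_sub, hT, termCoeff_monomial_smul_shift, ← leadCoeff_eq, hc,
        div_mul_cancel₀ _ (leadCoeff_ne_zero σ (hG g hg))]
      exact sub_self _
    rw [suppIndicator_of_mem ha, suppIndicator_of_notMem h1]
    exact zero_lt_one

/-- The terms divisible by the leading term of some element of `G`. -/
def leadMultiples (σ : ModuleOrdering ι r) (G : Multiset (FreeVec K ι r)) :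
    Set (ModTerm ι r) :=
  {T | ∃ U ∈ G, (leadTerm σ U).Dvd T}

/-- In an infinite ascending chain choose a term `T k` that is new at stage `k + 1`. If `T i`
divides `T j` with `i < j`, then `T j` is already covered at stage `j`. -/
theorem wellFounded_leadMultiples [Finite ι] (σ : ModuleOrdering ι r) :
    WellFounded fun G' G : Multiset (FreeVec K ι r) =>
      leadMultiples σ G ⊂ leadMultiples σ G' := by
  refine wellFounded_iff_isEmpty_descending_chain.2 ⟨fun ⟨f, hf⟩ => ?_⟩
  have hmono : Monotone fun k => leadMultiples σ (f k) :=
    monotone_nat_of_le_succ fun k => (hf k).subset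
  choose T hT hT' using fun k => Set.exists_of_ssubset (hf k)
  obtain ⟨i, j, hij, hdvd⟩ := ModTerm.exists_dvd T
  obtain ⟨U, hU, hUT⟩ := hT i
  exact hT' j (hmono (Nat.succ_le_of_lt hij) ⟨U, hU, hUT.trans hdvd⟩)

/-- The quantity that decreases in each step. -/
noncomputable def State.measure (S : State K m n r) :
    Multiset (FreeVec K (Fin m ⊕ Fin n) r) × ℕ × (ModTerm (Fin n) r →₀ ℕ) :=
  -- Choosing a generator or pair costs `2` and creates a remainder worth `1`, which is lost when
  -- the remainder is finished.
  (S.basis, 2 * (S.gens.card + S.pairs.card) + S.current.elim 0 fun _ => 1,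
    suppIndicator (dehVec (S.current.getD 0)))

variable {W : Matrix (Fin m) (Fin n) ℤ} {δ : Fin r → Fin m → ℤ} {σ : ModuleOrdering (Fin n) r}
  {M : Submodule (MvPolynomial (Fin n) K) (FreeVec K (Fin n) r)}

/-- Basis growth is measured upstairs, since non-divisibility is known only for leading terms in
`F̄`. Division is measured downstairs, where replacements change nothing and the term ordering `σ`
gives a well-founded comparison. -/
theorem Invariant.measure_lex {S S' : State K m n r} (h : Invariant W δ σ M S)
    (hs : Step W δ σ S S') :
    Prod.Lex (fun G' G => leadMultiples (σ.extend W δ) G ⊂ leadMultiples (σ.extend W δ) G')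
      (Prod.Lex (· < ·) (Finsupp.Lex (fun S T => σ.lt T S) (· < ·))) S'.measure S.measure := by
  cases hs with
  | chooseGen U gens pairs G =>
    refine Prod.Lex.right _ (Prod.Lex.left _ _ ?_)
    simp only [Multiset.card_cons, Option.elim]
    omega
  | choosePair U V gens pairs G =>
    refine Prod.Lex.right _ (Prod.Lex.left _ _ ?_)
    simp only [Multiset.card_cons, Option.elim]
    omega
  | reduce gens pairs G R R' R'' hsat hdiv =>
    refine Prod.Lex.right _ (Prod.Lex.right _ ?_)
    have hdiv' := hdiv.dehVec hsat.1 h.basis_hom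
    rw [hsat.dehVec_eq] at hdiv'
    refine hdiv'.suppIndicator_lex fun g hg => ?_
    obtain ⟨U, hU, rfl⟩ := Multiset.mem_map.1 hg
    exact (h.basis_hom U hU).1.dehVec_ne_zero (h.basis_hom U hU).2
  | finishZero gens pairs G R hsat =>
    refine Prod.Lex.right _ (Prod.Lex.left _ _ ?_)
    simp only [Option.elim]
    omega
  | finishNonzero gens pairs G R V hsat hV hirr =>
    refine Prod.Lex.left _ _ (Set.ssubset_iff_of_subset ?_ |>.2 ?_)
    · rintro T ⟨U, hU, hT⟩
      exact ⟨U, Multiset.mem_cons_of_mem hU, hT⟩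
    · refine ⟨leadTerm (σ.extend W δ) V, ⟨V, Multiset.mem_cons_self _ _, 0, by simp⟩, ?_⟩
      rintro ⟨U, hU, hT⟩
      exact hirr U hU hT

/-- With the trivial replacement of `R` by itself, a non-zero remainder is either irreducible at its
leading term, hence can be added, or admits a division step there. -/
theorem Invariant.isFinal_or_exists_step {S : State K m n r} (h : Invariant W δ σ M S) :
    (∃ G, S = finalState G) ∨ ∃ S', Step W δ σ S S' := by
  obtain ⟨gens, pairs, G, _ | R⟩ := S
  · induction gens using Multiset.induction_on with
    | cons U gens _ => exact Or.inr ⟨_, Step.chooseGen U gens pairs G⟩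
    | empty =>
      induction pairs using Multiset.induction_on with
      | cons p pairs _ => exact Or.inr ⟨_, Step.choosePair p.1 p.2 0 pairs G⟩
      | empty => exact Or.inl ⟨G, rfl⟩
  · right
    have hR : IsHomogeneousVec W δ R := h.current_hom R rfl
    by_cases h0 : R = 0
    · subst h0
      exact ⟨_, Step.finishZero gens pairs G 0 ⟨hR, rfl⟩⟩
    · by_cases hirr : ∀ U ∈ G, ¬ (leadTerm (σ.extend W δ) U).Dvd (leadTerm (σ.extend W δ) R)
      · exact ⟨_, Step.finishNonzero gens pairs G R R ⟨hR, rfl⟩ h0 hirr⟩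
      · push Not at hirr
        obtain ⟨U, hU, a, ha⟩ := hirr
        exact ⟨_, Step.reduce gens pairs G R R _ ⟨hR, rfl⟩
          ⟨U, hU, a, ha ▸ leadTerm_mem _ h0, rfl⟩⟩

theorem alwaysTerminates_homVec (hσ : σ.IsTermOrdering) {s : ℕ} (v : Fin s → FreeVec K (Fin n) r) :
    AlwaysTerminates W δ σ fun i => homVec W δ (v i) := by
  refine ⟨?_, fun S hS => hS.invariant.isFinal_or_exists_step⟩
  rintro ⟨f, hf0, hf⟩
  have hreach : ∀ k, Reachable W δ σ (fun i => homVec W δ (v i)) (f k) := by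
    intro k
    induction k with
    | zero => rw [hf0]; exact Relation.ReflTransGen.refl
    | succ k ih => exact ih.tail (hf k)
  have hwf := (wellFounded_leadMultiples (K := K) (σ.extend W δ)).prod_lex
    ((wellFounded_lt (α := ℕ)).prod_lex hσ.wellFounded_lex)
  exact (wellFounded_iff_isEmpty_descending_chain.1 hwf).false
    ⟨fun k => (f k).measure, fun k => (hreach k).invariant.measure_lex (hf k)⟩

end Termination

end SelfSat

theorem mainTheorem1 {K : Type*} [Field K] {m n r s : ℕ} [NeZero r] (hm : 1 ≤ m)
    (W : Matrix (Fin m) (Fin n) ℤ) (hW : W.rank = m) (δ : Fin r → Fin m → ℤ)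
    (σ : SelfSat.ModuleOrdering (Fin n) r)
    (v : Fin s → SelfSat.FreeVec K (Fin n) r) (hv : ∀ i, v i ≠ 0) :
    (∀ G : Multiset (SelfSat.FreeVec K (Fin m ⊕ Fin n) r),
      SelfSat.IsOutput W δ σ (fun i => SelfSat.homVec W δ (v i)) G →
        SelfSat.IsGroebnerBasis σ (Submodule.span (MvPolynomial (Fin n) K) (Set.range v))
          (SelfSat.dehVec '' {V | V ∈ G})) ∧
    (σ.IsTermOrdering → SelfSat.AlwaysTerminates W δ σ (fun i => SelfSat.homVec W δ (v i))) :=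
  ⟨fun _ hG => (SelfSat.Reachable.invariant hG).isGroebnerBasis,
    fun hσ => SelfSat.alwaysTerminates_homVec hσ v⟩
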